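/- Let $H_0,H_1$ be infinite-dimensional real Hilbert spaces with $H_1\subset H_0$ dense and with compact inclusion $\iota\colon H_1\to H_0$. A bounded operator $A\colon H_1\to H_0$ is called symmetrizable if there is an inner product $\langle\cdot,\cdot\rangle$ on $H_0$, equivalent to the given one, such that $\langle Ax,y\rangle=\langle x,Ay\rangle$ for all $x,y\in H_1$. Let $\mathcal F\subset\mathcal L(H_1,H_0)$ be the set of symmetrizable Fredholm operators of index zero, with the operator norm topology, and let $\mathcal A^*_{\mathbb R}$ be the set of continuous maps $A\colon\mathbb R\to\mathcal F$ for which both limits $\lim_{s\to\pm\infty}A(s)$ exist in $\mathcal L(H_1,H_0)$, belong to $\mathcal F$ and are invertible (no differentiability of $A$ is assumed). For $I\subset\mathbb R$ an interval put $P_0(I;H_0)=L^2(I,H_0)$, and let $P_1(\mathbb R;H_1,H_0)=L^2(\mathbb R,H_1)\cap W^{1,2}(\mathbb R,H_0)$ with norm $\|\xi\|_{P_1}^2=\int_{\mathbb R}\|\partial_s\xi(s)\|_{H_0}^2\,ds+\int_{\mathbb R}\|\xi(s)\|_{H_1}^2\,ds$, where $\partial_s$ is the weak derivative. For $A\in\mathcal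 A^*_{\mathbb R}$ let $D_A\colon P_1(\mathbb R;H_1,H_0)\to P_0(\mathbb R;H_0)$ be the bounded operator $D_A\xi=\partial_s\xi+A\xi$. With the dual inclusion $\iota^*\colon H_0^*\to H_1^*$ and the Banach adjoints $A(s)^*\colon H_0^*\to H_1^*$, let $P_1(\mathbb R;H_0^*,H_1^*)=L^2(\mathbb R,H_0^*)\cap W^{1,2}(\mathbb R,H_1^*)$, normed in the same way, and let $D_A^*\colon P_1(\mathbb R;H_0^*,H_1^*)\to P_0(\mathbb R;H_1^*)=L^2(\mathbb R,H_1^*)$ be $D_A^*\eta=\partial_s\eta-A(\cdot)^*\eta$. Then for every $A\in\mathcal A^*_{\mathbb R}$: (i) there are constants $c,T>0$ such that for all $\xi\in P_1(\mathbb R;H_1,H_0)$ $$\|\xi\|_{P_1(\mathbb R;H_1,H_0)}\le c\left(\|\xi\|_{P_0([-T,T];H_0)}+\|D_A\xi\|_{P_0(\mathbb R;H_0)}\right);$$ (ii) there are constants $c,T>0$ such that for all $\eta\in P_1(\mathbb R;H_0^*,H_1^*)$ $$\|\eta\|_{P_1(\mathbb R;H_0^*,H_1^*)}\le c\left(\|\eta\|_{P_0([-T,T];H_1^*)}+\|D_A^*\eta\|_{P_0(\mathbb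 R;H_1^*)}\right);$$ (iii) $D_A\colon P_1(\mathbb R;H_1,H_0)\to P_0(\mathbb R;H_0)$ is a Fredholm operator. -/

import Mathlib

set_option maxSynthPendingDepth 3

open MeasureTheory Filter Topology
open scoped ContDiff BoundedContinuousFunction

/-! Hilbert space pairs and Hessians. The inclusion `H₁ ⊆ H₀` is represented by an injective
continuous linear map `ι : H₁ → H₀`. -/

/-- Hilbert space pair: both spaces are infinite dimensional and the inclusion `ι : H₁ → H₀` is
injective and compact with dense image. -/
structure IsHilbertPair {H₀ H₁ : Type*} [NormedAddCommGroup H₀] [InnerProductSpace ℝ H₀]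
    [NormedAddCommGroup H₁] [InnerProductSpace ℝ H₁] (ι : H₁ →L[ℝ] H₀) : Prop where
  infinite_dim₀ : ¬ FiniteDimensional ℝ H₀
  infinite_dim₁ : ¬ FiniteDimensional ℝ H₁
  injective : Function.Injective ι
  dense : DenseRange ι
  compact : IsCompactOperator ι

/-- The bilinear form `B` is an inner product on `H` equivalent to the given one. (Positive
definiteness of `B` is part of the lower bound.) -/
def IsEquivInner {H : Type*} [NormedAddCommGroup H] [InnerProductSpace ℝ H]
    (B : LinearMap.BilinForm ℝ H) : Prop :=
  (∀ x y, B x y = B y x) ∧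
    ∃ c : ℝ, 0 < c ∧ ∀ x, c⁻¹ * ‖x‖ ≤ √(B x x) ∧ √(B x x) ≤ c * ‖x‖

/-- `A : H₁ → H₀` is symmetrizable: it is symmetric for some inner product on `H₀` equivalent to
the given one. -/
def IsSymmetrizable {H₀ H₁ : Type*} [NormedAddCommGroup H₀] [InnerProductSpace ℝ H₀]
    [NormedAddCommGroup H₁] [InnerProductSpace ℝ H₁] (ι A : H₁ →L[ℝ] H₀) : Prop :=
  ∃ B : LinearMap.BilinForm ℝ H₀, IsEquivInner B ∧ ∀ x y, B (A x) (ι y) = B (ι x) (A y)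

/-- Hessians: symmetrizable Fredholm operators `H₁ → H₀` of index zero. -/
structure IsHessian {H₀ H₁ : Type*} [NormedAddCommGroup H₀] [InnerProductSpace ℝ H₀]
    [NormedAddCommGroup H₁] [InnerProductSpace ℝ H₁] (ι A : H₁ →L[ℝ] H₀) : Prop where
  symmetrizable : IsSymmetrizable ι A
  fredholm : A.IsFredholm
  index_eq_zero : A.toLinearMap.index = 0

/-- The path space on the real line: norm continuous paths of Hessians which converge in operator
norm to invertible Hessians at `+∞` and at `-∞`. -/
structure IsHessianPath {H₀ H₁ : Type*} [NormedAddCommGroup H₀] [InnerProductSpace ℝ H₀]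
    [NormedAddCommGroup H₁] [InnerProductSpace ℝ H₁] (ι : H₁ →L[ℝ] H₀)
    (A : ℝ → (H₁ →L[ℝ] H₀)) : Prop where
  continuous : Continuous A
  hessian : ∀ s, IsHessian ι (A s)
  limit_top : ∃ A' : H₁ →L[ℝ] H₀, IsHessian ι A' ∧ A'.IsInvertible ∧ Tendsto A atTop (𝓝 A')
  limit_bot : ∃ A' : H₁ →L[ℝ] H₀, IsHessian ι A' ∧ A'.IsInvertible ∧ Tendsto A atBot (𝓝 A')

theorem IsHessianPath.bounded {H₀ H₁ : Type*} [NormedAddCommGroup H₀] [InnerProductSpace ℝ H₀]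
    [NormedAddCommGroup H₁] [InnerProductSpace ℝ H₁] {ι : H₁ →L[ℝ] H₀}
    {A : ℝ → (H₁ →L[ℝ] H₀)} (hA : IsHessianPath ι A) : ∃ C, ∀ s, ‖A s‖ ≤ C := by
  obtain ⟨Ap, -, -, hp⟩ := hA.limit_top
  obtain ⟨Am, -, -, hm⟩ := hA.limit_bot
  obtain ⟨b, hb⟩ := eventually_atTop.1 (hp.norm.eventually_le_const (lt_add_one ‖Ap‖))
  obtain ⟨a, ha⟩ := eventually_atBot.1 (hm.norm.eventually_le_const (lt_add_one ‖Am‖))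
  obtain ⟨K, hK⟩ := (isCompact_Icc (a := a) (b := b)).exists_bound_of_continuousOn
    hA.continuous.continuousOn
  refine ⟨max K (max (‖Ap‖ + 1) (‖Am‖ + 1)), fun s => ?_⟩
  by_cases h1 : s ≤ a
  · exact (ha s h1).trans (by simp)
  by_cases h2 : b ≤ s
  · exact (hb s h2).trans (by simp)
  exact (hK s ⟨by linarith, by linarith⟩).trans (by simp)

/-- A path in the path space, bundled as a bounded continuous function. -/
noncomputable def IsHessianPath.toBCF {H₀ H₁ : Type*} [NormedAddCommGroup H₀]
    [InnerProductSpace ℝ H₀] [NormedAddCommGroup H₁] [InnerProductSpace ℝ H₁] {ι : H₁ →L[ℝ] H₀}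
    {A : ℝ → (H₁ →L[ℝ] H₀)} (hA : IsHessianPath ι A) : ℝ →ᵇ (H₁ →L[ℝ] H₀) :=
  BoundedContinuousFunction.ofNormedAddCommGroup A hA.continuous hA.bounded.choose
    hA.bounded.choose_spec

/-! The path spaces over the real line. They are defined for normed spaces `E₁`, `E₀` and a
continuous linear map `ι : E₁ → E₀`, so that they apply to `ι : H₁ → H₀` and to its adjoint
`H₀* → H₁*`. -/

/-- `g` is a weak derivative of `f : ℝ → E`. -/
def HasWeakDeriv {E : Type*} [NormedAddCommGroup E] [NormedSpace ℝ E] (f g : ℝ → E) : Prop :=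
  ∀ φ : ℝ → ℝ, ContDiff ℝ ∞ φ → HasCompactSupport φ →
    ∫ s, deriv φ s • f s = -∫ s, φ s • g s

/-- `P₀(ℝ; E) = L²(ℝ, E)`. -/
abbrev PathL2 (E : Type*) [NormedAddCommGroup E] : Type _ :=
  Lp E 2 (volume : Measure ℝ)

theorem integrable_smul_pathL2 {E : Type*} [NormedAddCommGroup E] [NormedSpace ℝ E] {φ : ℝ → ℝ}
    (hφ : Continuous φ) (hc : HasCompactSupport φ) (f : PathL2 E) :
    Integrable (fun s => φ s • f s) :=
  ((Lp.memLp f).locallyIntegrable one_le_two).integrable_smul_left_of_hasCompactSupport hφ hc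

/-- `P₁(ℝ; E₁, E₀) = L²(ℝ, E₁) ∩ W^{1,2}(ℝ, E₀)`: the elements are the pairs `(ξ, ∂ξ)` where
`ξ ∈ L²(ℝ, E₁)` and `∂ξ ∈ L²(ℝ, E₀)` is the weak derivative of `ι ∘ ξ`. The norm is
`‖ξ‖² = ‖∂ξ‖²_{L²(ℝ, E₀)} + ‖ξ‖²_{L²(ℝ, E₁)}`. -/
def PathW {E₀ E₁ : Type*} [NormedAddCommGroup E₀] [NormedSpace ℝ E₀]
    [NormedAddCommGroup E₁] [NormedSpace ℝ E₁] (ι : E₁ →L[ℝ] E₀) :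
    Submodule ℝ (WithLp 2 (PathL2 E₁ × PathL2 E₀)) where
  carrier := {p | HasWeakDeriv (fun s => ι (p.fst s)) (fun s => p.snd s)}
  zero_mem' := fun φ _ _ => by
    have h1 : ∀ᵐ s : ℝ, deriv φ s • ι ((0 : PathL2 E₁) s) = 0 := by
      filter_upwards [Lp.coeFn_zero E₁ 2 (volume : Measure ℝ)] with s hs
      rw [hs]; simp
    have h2 : ∀ᵐ s : ℝ, φ s • (0 : PathL2 E₀) s = 0 := by
      filter_upwards [Lp.coeFn_zero E₀ 2 (volume : Measure ℝ)] with s hs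
      rw [hs]; simp
    change ∫ s, deriv φ s • ι ((0 : PathL2 E₁) s) = -∫ s, φ s • (0 : PathL2 E₀) s
    rw [integral_eq_zero_of_ae h1, integral_eq_zero_of_ae h2, neg_zero]
  add_mem' := by
    intro p q hp hq φ h h'
    have hd : Continuous (deriv φ) := h.continuous_deriv (by simp)
    have i1 := fun f : PathL2 E₁ => (ι.integrable_comp (integrable_smul_pathL2 hd h'.deriv f))
    have i2 := integrable_smul_pathL2 (E := E₀) h.continuous h'
    simp only [map_smul] at i1
    have e1 : ∀ᵐ s : ℝ, deriv φ s • ι ((p + q).fst s)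
        = deriv φ s • ι (p.fst s) + deriv φ s • ι (q.fst s) := by
      filter_upwards [Lp.coeFn_add p.fst q.fst] with s hs
      rw [WithLp.add_fst, hs, Pi.add_apply, map_add, smul_add]
    have e2 : ∀ᵐ s : ℝ, φ s • (p + q).snd s = φ s • p.snd s + φ s • q.snd s := by
      filter_upwards [Lp.coeFn_add p.snd q.snd] with s hs
      rw [WithLp.add_snd, hs, Pi.add_apply, smul_add]
    change ∫ s, deriv φ s • ι ((p + q).fst s) = -∫ s, φ s • (p + q).snd s
    rw [integral_congr_ae e1, integral_congr_ae e2, integral_add (i1 _) (i1 _),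
      integral_add (i2 _) (i2 _), hp φ h h', hq φ h h', neg_add]
  smul_mem' := by
    intro c p hp φ h h'
    have e1 : ∀ᵐ s : ℝ, deriv φ s • ι ((c • p).fst s) = c • (deriv φ s • ι (p.fst s)) := by
      filter_upwards [Lp.coeFn_smul c p.fst] with s hs
      rw [WithLp.smul_fst, hs, Pi.smul_apply, map_smul, smul_comm]
    have e2 : ∀ᵐ s : ℝ, φ s • (c • p).snd s = c • (φ s • p.snd s) := by
      filter_upwards [Lp.coeFn_smul c p.snd] with s hs
      rw [WithLp.smul_snd, hs, Pi.smul_apply, smul_comm]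
    change ∫ s, deriv φ s • ι ((c • p).fst s) = -∫ s, φ s • (c • p).snd s
    rw [integral_congr_ae e1, integral_congr_ae e2, integral_smul, integral_smul, hp φ h h',
      smul_neg]

/-- An element of `P₁` is determined by its component in `L²(ℝ, E₁)`: weak derivatives are
unique. -/
theorem PathW.ext_fst {E₀ E₁ : Type*} [NormedAddCommGroup E₀] [NormedSpace ℝ E₀] [CompleteSpace E₀]
    [NormedAddCommGroup E₁] [NormedSpace ℝ E₁] {ι : E₁ →L[ℝ] E₀} {p q : PathW ι}
    (h : p.1.fst = q.1.fst) : p = q := by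
  have hs : p.1.snd = q.1.snd := by
    refine Lp.ext (ae_eq_of_integral_contDiff_smul_eq
      ((Lp.memLp _).locallyIntegrable one_le_two) ((Lp.memLp _).locallyIntegrable one_le_two)
      fun φ hφ hc => neg_injective ?_)
    rw [← p.2 φ hφ hc, ← q.2 φ hφ hc, h]
  exact Subtype.ext (WithLp.ofLp_injective 2 (Prod.ext h hs))

theorem memLp_pathMul {E₀ E₁ : Type*} [NormedAddCommGroup E₀] [NormedSpace ℝ E₀]
    [NormedAddCommGroup E₁] [NormedSpace ℝ E₁] (A : ℝ →ᵇ (E₁ →L[ℝ] E₀)) (f : PathL2 E₁) :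
    MemLp (fun s => A s (f s)) 2 (volume : Measure ℝ) := by
  have hm : AEStronglyMeasurable (fun s => A s (f s)) (volume : Measure ℝ) :=
    (ContinuousLinearMap.id ℝ (E₁ →L[ℝ] E₀)).aestronglyMeasurable_comp₂
      A.continuous.aestronglyMeasurable (Lp.aestronglyMeasurable f)
  exact (Lp.memLp f).of_le_mul hm
    (Eventually.of_forall fun s => (A s).le_of_opNorm_le (A.norm_coe_le_norm s) _)

/-- Multiplication by a bounded continuous path of operators, `L²(ℝ, E₁) → L²(ℝ, E₀)`,
`(A f)(s) = A(s) f(s)`. -/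
noncomputable def pathMul {E₀ E₁ : Type*} [NormedAddCommGroup E₀] [NormedSpace ℝ E₀]
    [NormedAddCommGroup E₁] [NormedSpace ℝ E₁] (A : ℝ →ᵇ (E₁ →L[ℝ] E₀)) :
    PathL2 E₁ →L[ℝ] PathL2 E₀ :=
  LinearMap.mkContinuous
    { toFun := fun f => (memLp_pathMul A f).toLp (fun s => A s (f s))
      map_add' := fun f g => by
        rw [← MemLp.toLp_add (memLp_pathMul A f) (memLp_pathMul A g)]
        refine MemLp.toLp_congr _ _ ?_
        filter_upwards [Lp.coeFn_add f g] with s hs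
        rw [hs, Pi.add_apply, map_add, Pi.add_apply]
      map_smul' := fun c f => by
        rw [RingHom.id_apply, ← MemLp.toLp_const_smul c (memLp_pathMul A f)]
        refine MemLp.toLp_congr _ _ ?_
        filter_upwards [Lp.coeFn_smul c f] with s hs
        rw [hs, Pi.smul_apply, map_smul, Pi.smul_apply] }
    ‖A‖ fun f => by
      refine Lp.norm_le_mul_norm_of_ae_le_mul ?_
      filter_upwards [(memLp_pathMul A f).coeFn_toLp] with s hs
      simp only [LinearMap.coe_mk, AddHom.coe_mk]
      rw [hs]
      exact (A s).le_of_opNorm_le (A.norm_coe_le_norm s) _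

/-- `D_A : P₁(ℝ; E₁, E₀) → P₀(ℝ; E₀)`, `ξ ↦ ∂ξ + A ξ`. -/
noncomputable def pathOp {E₀ E₁ : Type*} [NormedAddCommGroup E₀] [NormedSpace ℝ E₀]
    [NormedAddCommGroup E₁] [NormedSpace ℝ E₁] (ι : E₁ →L[ℝ] E₀) (A : ℝ →ᵇ (E₁ →L[ℝ] E₀)) :
    PathW ι →L[ℝ] PathL2 E₀ :=
  (WithLp.sndL 2 ℝ (PathL2 E₁) (PathL2 E₀)
    + pathMul A ∘L WithLp.fstL 2 ℝ (PathL2 E₁) (PathL2 E₀)) ∘L (PathW ι).subtypeL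

/-- The norm `‖ξ‖` of (the restriction of) `ξ ∈ P₁(ℝ; E₁, E₀)` in `P₀([-T, T]; E₀)`. -/
noncomputable def normOnIcc {E₀ E₁ : Type*} [NormedAddCommGroup E₀] [NormedSpace ℝ E₀]
    [NormedAddCommGroup E₁] [NormedSpace ℝ E₁] {ι : E₁ →L[ℝ] E₀} (T : ℝ) (ξ : PathW ι) : ℝ :=
  √(∫ s in Set.Icc (-T) T, ‖ι (ξ.1.fst s)‖ ^ 2)

/-- The Banach adjoint `A ↦ A* : E₀* → E₁*`, `(A* η) x = η (A x)`, which is continuous and linear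
in `A`. -/
noncomputable def banachAdjoint {E₀ E₁ : Type*} [NormedAddCommGroup E₀] [NormedSpace ℝ E₀]
    [NormedAddCommGroup E₁] [NormedSpace ℝ E₁] :
    (E₁ →L[ℝ] E₀) →L[ℝ] (StrongDual ℝ E₀ →L[ℝ] StrongDual ℝ E₁) :=
  (ContinuousLinearMap.compL ℝ E₁ E₀ ℝ).flip

/-- The path `s ↦ -A(s)*` of operators `E₀* → E₁*`. -/
noncomputable def negAdjointPath {E₀ E₁ : Type*} [NormedAddCommGroup E₀] [NormedSpace ℝ E₀]
    [NormedAddCommGroup E₁] [NormedSpace ℝ E₁] (A : ℝ →ᵇ (E₁ →L[ℝ] E₀)) :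
    ℝ →ᵇ (StrongDual ℝ E₀ →L[ℝ] StrongDual ℝ E₁) :=
  BoundedContinuousFunction.ofNormedAddCommGroup (fun s => -banachAdjoint (A s))
    (banachAdjoint.continuous.comp A.continuous).neg
    (‖(banachAdjoint : (E₁ →L[ℝ] E₀) →L[ℝ] _)‖ * ‖A‖) fun s => by
      rw [norm_neg]
      exact (banachAdjoint (E₀ := E₀) (E₁ := E₁)).le_opNorm_of_le (A.norm_coe_le_norm s)

/-! Freeze the operator first. If `A` is constant and symmetric for an equivalent inner product `b`,
then the integral of `b(∂ξ, Aξ)` vanishes, so the `b`-square of `∂ξ + Aξ` integrates to that of `∂ξ`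
plus that of `Aξ`. Combined with the elliptic bound `‖x‖² ≤ K‖Ax‖² + K'‖ιx‖²`, this is
`modelEstimate_of_symm`; for invertible `A` one may take `K' = 0`. The cross term is removed by
translating `ξ` in time (`PathW.lpPairing_deriv_eq_zero`), using no time regularity beyond
`W^{1,2}`.

A norm continuous path is close to a constant on short intervals and close to its limits near the
two ends. A cut-off argument (`ModelEstimate.setEstimate`) absorbs the difference; compactness
leaves finitely many pieces, and at the ends `K' = 0` makes the error term live on a bounded
interval. This gives (i) in `exists_global_estimate`.

The same machine gives (ii) once `-A*` is known to be symmetric for an inner product on `H₁*`. The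
form dual to the graph form `b(Ax, Ay) + b(ιx, ιy)` works (`IsHessian.exists_form_dual`), because
symmetry together with index zero makes a Hessian self-adjoint.

For (iii), the restriction to `[-T, T]` is small on subspaces of finite codimension: Poincaré on
short intervals reduces this to finitely many means, on which compactness of `ι` acts. With (i) this
yields closed range and finite dimensional kernel (`IsSmallModFinite.semiFredholm`). Elements
orthogonal to the range lie in the kernel of `D_A^*`, which is finite dimensional by (ii). -/

/-! ### Translations of square integrable paths -/

/-- Translation `(τ_t f)(s) = f (t + s)` on `L²(ℝ, E)`. -/
noncomputable def pathTranslate {E : Type*} [NormedAddCommGroup E] [NormedSpace ℝ E] (t : ℝ) :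
    PathL2 E →ₗᵢ[ℝ] PathL2 E :=
  Lp.compMeasurePreservingₗᵢ ℝ (fun s => t + s) (measurePreserving_add_left volume t)

theorem coeFn_pathTranslate {E : Type*} [NormedAddCommGroup E] [NormedSpace ℝ E] (t : ℝ)
    (f : PathL2 E) : pathTranslate t f =ᵐ[volume] fun s => f (t + s) :=
  Lp.coeFn_compMeasurePreserving f (measurePreserving_add_left volume t)

theorem continuous_pathTranslate {E : Type*} [NormedAddCommGroup E] [NormedSpace ℝ E]
    (f : PathL2 E) : Continuous fun t => pathTranslate t f := by
  have h : Continuous fun t : ℝ => (ContinuousMap.mk (fun s : ℝ => t + s) : C(ℝ, ℝ)) :=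
    ContinuousMap.continuous_of_continuous_uncurry _
      (show Continuous fun p : ℝ × ℝ => p.1 + p.2 by fun_prop)
  exact (continuous_const (y := f)).compMeasurePreservingLp h
    (fun t => measurePreserving_add_left volume t) (by simp)

theorem pathTranslate_zero {E : Type*} [NormedAddCommGroup E] [NormedSpace ℝ E]
    (f : PathL2 E) : pathTranslate 0 f = f := by
  refine Lp.ext ?_
  filter_upwards [coeFn_pathTranslate 0 f] with s hs
  rw [hs, zero_add]

/-- Integration of square integrable paths against a test function. -/
noncomputable def testL {E : Type*} [NormedAddCommGroup E] [NormedSpace ℝ E] [CompleteSpace E]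
    {φ : ℝ → ℝ} (hφ : MemLp φ 2 (volume : Measure ℝ)) : PathL2 E →L[ℝ] E :=
  (ContinuousLinearMap.lsmul ℝ ℝ).lpPairing volume 2 2 (hφ.toLp φ)

theorem testL_apply {E : Type*} [NormedAddCommGroup E] [NormedSpace ℝ E] [CompleteSpace E]
    {φ : ℝ → ℝ} (hφ : MemLp φ 2 (volume : Measure ℝ)) (f : PathL2 E) :
    testL hφ f = ∫ s, φ s • f s := by
  rw [testL, ContinuousLinearMap.lpPairing_eq_integral]
  refine integral_congr_ae ?_
  filter_upwards [hφ.coeFn_toLp] with s hs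
  rw [hs]; rfl

theorem memLp_of_test {φ : ℝ → ℝ} (hφ : Continuous φ) (hc : HasCompactSupport φ) :
    MemLp φ 2 (volume : Measure ℝ) :=
  hφ.memLp_of_hasCompactSupport hc

theorem pathL2_ext_test {E : Type*} [NormedAddCommGroup E] [NormedSpace ℝ E] [CompleteSpace E]
    {f g : PathL2 E} (h : ∀ φ : ℝ → ℝ, ContDiff ℝ ∞ φ → HasCompactSupport φ →
      ∫ s, φ s • f s = ∫ s, φ s • g s) : f = g :=
  Lp.ext (ae_eq_of_integral_contDiff_smul_eq
      ((Lp.memLp _).locallyIntegrable one_le_two) ((Lp.memLp _).locallyIntegrable one_le_two) h)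

/-- As a function of the shift, the pairing is a convolution with the reflected test function. The
derivative falls on that smooth factor, and the definition of the weak derivative moves it back to
`f`. -/
theorem HasWeakDeriv.hasDerivAt_integral_translate {E : Type*} [NormedAddCommGroup E]
    [NormedSpace ℝ E] [CompleteSpace E] {f g : ℝ → E} (h : HasWeakDeriv f g)
    (hf : LocallyIntegrable f)
    {φ : ℝ → ℝ} (hφ : ContDiff ℝ ∞ φ) (hc : HasCompactSupport φ) (t : ℝ) :
    HasDerivAt (fun t => ∫ s, φ s • f (t + s)) (∫ s, φ s • g (t + s)) t := by
  set ψ : ℝ → ℝ := fun s => φ (-s) with hψ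
  have hψd : ContDiff ℝ ∞ ψ := hφ.comp contDiff_neg
  have hψc : HasCompactSupport ψ := hc.comp_homeomorph (Homeomorph.neg ℝ)
  have key : ∀ u : ℝ → E, (fun t => ∫ s, φ s • u (t + s)) =
      convolution ψ u (ContinuousLinearMap.lsmul ℝ ℝ) volume := by
    intro u
    ext t
    rw [convolution, ← integral_neg_eq_self]
    simp [hψ, sub_eq_add_neg]
  have e2 : ∫ s, φ s • g (t + s) = (convolution (deriv ψ) f (ContinuousLinearMap.lsmul ℝ ℝ)
      volume) t := by
    have h1 := h (fun u => φ (u - t)) (hφ.comp (contDiff_id.sub contDiff_const))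
      (hc.comp_homeomorph (Homeomorph.subRight t))
    have h2 : ∫ s, φ s • g (t + s) = ∫ s, φ (s - t) • g s := by
      rw [← integral_add_left_eq_self (fun s => φ (s - t) • g s) t]
      simp
    rw [h2, ← neg_eq_iff_eq_neg.2 h1.symm.symm, convolution]
    simp only [ContinuousLinearMap.lsmul_apply]
    rw [
      ← integral_neg_eq_self (fun u => deriv ψ u • f (t - u)),
      ← integral_add_left_eq_self (fun u => deriv ψ (-u) • f (t - -u)) (-t), ← integral_neg]
    refine integral_congr_ae (.of_forall fun s => ?_)
    have e3 : deriv (fun u => φ (u - t)) s = deriv φ (s - t) := deriv_comp_sub_const ..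
    have e4 : deriv ψ (-(-t + s)) = - deriv φ (-t + s) := by
      rw [hψ, deriv_comp_neg]; simp
    simp only [e3, e4]
    rw [show t - -(-t + s) = s by ring, show s - t = -t + s by ring, neg_smul]
  rw [key f, e2]
  exact hψc.hasDerivAt_convolution_left (ContinuousLinearMap.lsmul ℝ ℝ)
    (hψd.of_le (by exact_mod_cast le_top)) hf t

/-- The fundamental theorem of calculus holds after pairing with each test function, and these
pairings separate points of `L²`. The right side is a Bochner integral in `L²` of a continuous
integrand, so both the Lipschitz bound and differentiability in norm at zero follow from it. -/
theorem HasWeakDeriv.pathTranslate_sub_eq_integral {E : Type*} [NormedAddCommGroup E]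
    [NormedSpace ℝ E] [CompleteSpace E] {f g : PathL2 E} (h : HasWeakDeriv f g) (t : ℝ) :
    pathTranslate t f - f = ∫ r in (0 : ℝ)..t, pathTranslate r g := by
  refine pathL2_ext_test fun φ hφ hc => ?_
  have hm := memLp_of_test hφ.continuous hc
  rw [← testL_apply hm, ← testL_apply hm]
  have hcont : Continuous fun r => pathTranslate r g := continuous_pathTranslate g
  rw [← ContinuousLinearMap.intervalIntegral_comp_comm _ (hcont.intervalIntegrable _ _), map_sub]
  have e : ∀ (u : PathL2 E) r, testL hm (pathTranslate r u) = ∫ s, φ s • u (r + s) := by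
    intro u r
    rw [testL_apply]
    refine integral_congr_ae ?_
    filter_upwards [coeFn_pathTranslate r u] with s hs
    rw [hs]
  have hd : ∀ r, HasDerivAt (fun r => testL hm (pathTranslate r f))
      (testL hm (pathTranslate r g)) r := by
    intro r
    simp only [e]
    exact h.hasDerivAt_integral_translate ((Lp.memLp _).locallyIntegrable one_le_two) hφ hc r
  rw [intervalIntegral.integral_eq_sub_of_hasDerivAt (fun r _ => hd r)
    (((testL hm).continuous.comp hcont).intervalIntegrable _ _), pathTranslate_zero]

theorem HasWeakDeriv.norm_pathTranslate_sub_le {E : Type*} [NormedAddCommGroup E]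
    [NormedSpace ℝ E] [CompleteSpace E] {f g : PathL2 E} (h : HasWeakDeriv f g) (t : ℝ) :
    ‖pathTranslate t f - f‖ ≤ |t| * ‖g‖ := by
  rw [h.pathTranslate_sub_eq_integral t]
  refine (intervalIntegral.norm_integral_le_of_norm_le_const (C := ‖g‖) fun r _ => ?_).trans ?_
  · simp
  · simp [mul_comm]

theorem HasWeakDeriv.hasDerivAt_pathTranslate {E : Type*} [NormedAddCommGroup E]
    [NormedSpace ℝ E] [CompleteSpace E] {f g : PathL2 E} (h : HasWeakDeriv f g) :
    HasDerivAt (fun t => pathTranslate t f) g 0 := by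
  have hcont : Continuous fun r => pathTranslate r g := continuous_pathTranslate g
  have h1 := intervalIntegral.integral_hasDerivAt_right (hcont.intervalIntegrable 0 0)
    (hcont.stronglyMeasurableAtFilter _ _) hcont.continuousAt
  rw [pathTranslate_zero] at h1
  have h2 := h1.add_const f
  refine h2.congr_of_eventuallyEq (.of_forall fun t => ?_)
  beta_reduce
  rw [← h.pathTranslate_sub_eq_integral t, sub_add_cancel]

/-! ### Constant operator paths -/

/-- The operator `L²(ℝ, E₁) → L²(ℝ, E₀)` induced by a single operator `E₁ → E₀`. -/
noncomputable abbrev pathConst {E₀ E₁ : Type*} [NormedAddCommGroup E₀] [NormedSpace ℝ E₀]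
    [NormedAddCommGroup E₁] [NormedSpace ℝ E₁] (A : E₁ →L[ℝ] E₀) : PathL2 E₁ →L[ℝ] PathL2 E₀ :=
  pathMul (BoundedContinuousFunction.const ℝ A)

theorem coeFn_pathMul {E₀ E₁ : Type*} [NormedAddCommGroup E₀] [NormedSpace ℝ E₀]
    [NormedAddCommGroup E₁] [NormedSpace ℝ E₁] (A : ℝ →ᵇ (E₁ →L[ℝ] E₀)) (f : PathL2 E₁) :
    pathMul A f =ᵐ[volume] fun s => A s (f s) :=
  (memLp_pathMul A f).coeFn_toLp

theorem coeFn_pathConst {E₀ E₁ : Type*} [NormedAddCommGroup E₀] [NormedSpace ℝ E₀]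
    [NormedAddCommGroup E₁] [NormedSpace ℝ E₁] (A : E₁ →L[ℝ] E₀) (f : PathL2 E₁) :
    pathConst A f =ᵐ[volume] fun s => A (f s) :=
  coeFn_pathMul _ f

theorem HasWeakDeriv.congr_left {E : Type*} [NormedAddCommGroup E] [NormedSpace ℝ E]
    {f f' g : ℝ → E} (h : HasWeakDeriv f g) (e : f =ᵐ[volume] f') : HasWeakDeriv f' g := by
  intro φ hφ hc
  rw [← h φ hφ hc]
  refine integral_congr_ae ?_
  filter_upwards [e] with s hs
  rw [hs]

theorem HasWeakDeriv.congr_right {E : Type*} [NormedAddCommGroup E] [NormedSpace ℝ E]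
    {f g g' : ℝ → E} (h : HasWeakDeriv f g) (e : g =ᵐ[volume] g') : HasWeakDeriv f g' := by
  intro φ hφ hc
  rw [h φ hφ hc]
  congr 1
  refine integral_congr_ae ?_
  filter_upwards [e] with s hs
  rw [hs]

theorem PathW.hasWeakDeriv {E₀ E₁ : Type*} [NormedAddCommGroup E₀] [NormedSpace ℝ E₀]
    [NormedAddCommGroup E₁] [NormedSpace ℝ E₁] {ι : E₁ →L[ℝ] E₀} (ξ : PathW ι) :
    HasWeakDeriv (pathConst ι ξ.1.fst) ξ.1.snd :=
  HasWeakDeriv.congr_left (f := fun s => ι (ξ.1.fst s)) ξ.2 (coeFn_pathConst ι ξ.1.fst).symm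

/-- For a symmetric operator `A` the function `s ↦ B (∂ξ(s), A ξ(s))` has integral zero. -/
theorem PathW.lpPairing_deriv_eq_zero {E₀ E₁ : Type*} [NormedAddCommGroup E₀] [NormedSpace ℝ E₀]
    [CompleteSpace E₀] [NormedAddCommGroup E₁] [NormedSpace ℝ E₁] {ι A : E₁ →L[ℝ] E₀}
    {B : E₀ →L[ℝ] E₀ →L[ℝ] ℝ} (hB : ∀ x y, B x y = B y x)
    (hA : ∀ x y, B (A x) (ι y) = B (ι x) (A y)) (ξ : PathW ι) :
    B.lpPairing volume 2 2 ξ.1.snd (pathConst A ξ.1.fst) = 0 := by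
  set f := pathConst ι ξ.1.fst with hf
  set a := pathConst A ξ.1.fst with ha
  have hd := (PathW.hasWeakDeriv ξ).hasDerivAt_pathTranslate
  have hd' : HasDerivAt (fun t => pathTranslate (-t) f) (-ξ.1.snd) 0 := by
    have := HasDerivAt.scomp (0 : ℝ) (h := fun t : ℝ => -t) (by simpa using hd)
      (hasDerivAt_neg (0 : ℝ))
    simpa [Function.comp_def] using this
  -- Symmetry of `A` and a shift of the integration variable make the pairing an even function of
  -- `t`. Its derivative at zero is the integral in question, which therefore equals its own
  -- negative.
  have hsym : ∀ t, B.lpPairing volume 2 2 (pathTranslate t f) a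
      = B.lpPairing volume 2 2 (pathTranslate (-t) f) a := by
    intro t
    rw [ContinuousLinearMap.lpPairing_eq_integral, ContinuousLinearMap.lpPairing_eq_integral,
      ← integral_add_left_eq_self (fun s => B (pathTranslate (-t) f s) (a s)) t]
    refine integral_congr_ae ?_
    have q := (measurePreserving_add_left (volume : Measure ℝ) t).quasiMeasurePreserving
    filter_upwards [coeFn_pathTranslate t f, q.ae (coeFn_pathTranslate (-t) f),
      q.ae (coeFn_pathConst A ξ.1.fst), coeFn_pathConst A ξ.1.fst, coeFn_pathConst ι ξ.1.fst,
      q.ae (coeFn_pathConst ι ξ.1.fst)] with s h1 h2 h3 h4 h5 h6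
    rw [h1, h2, h3, h4, neg_add_cancel_left, h5, h6, ← hA, hB]
  have h1 := (((B.lpPairing volume 2 2).flip a).hasFDerivAt.comp_hasDerivAt (0 : ℝ) hd)
  have h2 := (((B.lpPairing volume 2 2).flip a).hasFDerivAt.comp_hasDerivAt (0 : ℝ) hd')
  have h3 : ((B.lpPairing volume 2 2).flip a ∘ fun t => pathTranslate t f)
      = ((B.lpPairing volume 2 2).flip a ∘ fun t => pathTranslate (-t) f) := by
    ext t; exact hsym t
  rw [h3] at h1
  have h4 := h1.unique h2
  rw [map_neg] at h4
  simp only [ContinuousLinearMap.flip_apply] at h4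
  linarith

/-! ### The estimate for constant operators -/

theorem PathL2.integrable_norm_sq {E : Type*} [NormedAddCommGroup E] (f : PathL2 E) :
    Integrable (fun s => ‖f s‖ ^ 2) :=
  (Lp.memLp f).integrable_norm_pow two_ne_zero

theorem PathL2.norm_sq_eq {E : Type*} [NormedAddCommGroup E] (f : PathL2 E) :
    ‖f‖ ^ 2 = ∫ s, ‖f s‖ ^ 2 := by
  have h := (Lp.memLp f).eLpNorm_eq_integral_rpow_norm two_ne_zero (by simp)
  have h0 : 0 ≤ ∫ s, ‖f s‖ ^ 2 := integral_nonneg fun s => by positivity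
  rw [Lp.norm_def, h, ENNReal.toReal_ofReal (by positivity)]
  simp only [ENNReal.toReal_ofNat, Real.rpow_two]
  rw [← Real.rpow_natCast, ← Real.rpow_mul h0]
  norm_num

/-- The estimate `‖∂ξ‖² + ‖ξ‖² ≤ C ‖∂ξ + A ξ‖² + C' ‖ι ξ‖²` in the `L²` norms over the real line,
for a constant operator `A`. -/
def ModelEstimate {E₀ E₁ : Type*} [NormedAddCommGroup E₀] [NormedSpace ℝ E₀]
    [NormedAddCommGroup E₁] [NormedSpace ℝ E₁] (ι A : E₁ →L[ℝ] E₀) (C C' : ℝ) : Prop :=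
  ∀ ξ : PathW ι, ‖ξ.1.snd‖ ^ 2 + ‖ξ.1.fst‖ ^ 2 ≤
    C * ‖ξ.1.snd + pathConst A ξ.1.fst‖ ^ 2 + C' * ‖pathConst ι ξ.1.fst‖ ^ 2

theorem lpPairing_self_ge {E : Type*} [NormedAddCommGroup E] [NormedSpace ℝ E]
    {B : E →L[ℝ] E →L[ℝ] ℝ} {c : ℝ} (hc : ∀ x, c * ‖x‖ ^ 2 ≤ B x x) (f : PathL2 E) :
    c * ‖f‖ ^ 2 ≤ B.lpPairing volume 2 2 f f := by
  rw [ContinuousLinearMap.lpPairing_eq_integral, PathL2.norm_sq_eq, ← integral_const_mul]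
  refine integral_mono ((PathL2.integrable_norm_sq f).const_mul c) ?_ fun s => hc _
  exact memLp_one_iff_integrable.1 (B.memLp_of_bilin 1 (Lp.memLp f) (Lp.memLp f))

theorem lpPairing_self_le {E : Type*} [NormedAddCommGroup E] [NormedSpace ℝ E]
    (B : E →L[ℝ] E →L[ℝ] ℝ) (f : PathL2 E) :
    B.lpPairing volume 2 2 f f ≤ ‖B‖ * ‖f‖ ^ 2 := by
  rw [ContinuousLinearMap.lpPairing_eq_integral, PathL2.norm_sq_eq, ← integral_const_mul]
  refine integral_mono ?_ ((PathL2.integrable_norm_sq f).const_mul _) fun s => ?_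
  · exact memLp_one_iff_integrable.1 (B.memLp_of_bilin 1 (Lp.memLp f) (Lp.memLp f))
  · refine (Real.le_norm_self _).trans ((B.le_opNorm₂ _ _).trans_eq ?_)
    ring

/-- Without cross terms, `B` evaluated on `∂ξ + Aξ` controls `∂ξ` and `Aξ` separately, with loss
`‖B‖ / c`. The pointwise elliptic bound then recovers `ξ` from `Aξ`, which accounts for the factor
`1 + K`. -/
theorem modelEstimate_of_symm {E₀ E₁ : Type*} [NormedAddCommGroup E₀] [NormedSpace ℝ E₀]
    [CompleteSpace E₀] [NormedAddCommGroup E₁] [NormedSpace ℝ E₁] {ι A : E₁ →L[ℝ] E₀}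
    {B : E₀ →L[ℝ] E₀ →L[ℝ] ℝ} (hB : ∀ x y, B x y = B y x) {c : ℝ} (hc0 : 0 < c)
    (hc : ∀ x, c * ‖x‖ ^ 2 ≤ B x x) (hA : ∀ x y, B (A x) (ι y) = B (ι x) (A y))
    {K K' : ℝ} (hK : 0 ≤ K) (hell : ∀ x, ‖x‖ ^ 2 ≤ K * ‖A x‖ ^ 2 + K' * ‖ι x‖ ^ 2) :
    ModelEstimate ι A ((1 + K) * (‖B‖ / c)) K' := by
  intro ξ
  set d := ξ.1.snd with hd
  set a := pathConst A ξ.1.fst with ha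
  have h0 : B.lpPairing volume 2 2 d a = 0 := PathW.lpPairing_deriv_eq_zero hB hA ξ
  have h0' : B.lpPairing volume 2 2 a d = 0 := by
    rw [← h0, ContinuousLinearMap.lpPairing_eq_integral, ContinuousLinearMap.lpPairing_eq_integral]
    simp only [hB]
  have h1 : B.lpPairing volume 2 2 (d + a) (d + a)
      = B.lpPairing volume 2 2 d d + B.lpPairing volume 2 2 a a := by
    simp [h0, h0']
  have h2 := lpPairing_self_ge hc d
  have h3 := lpPairing_self_ge hc a
  have h4 := lpPairing_self_le B (d + a)
  have h5 : ‖d‖ ^ 2 + ‖a‖ ^ 2 ≤ ‖B‖ / c * ‖d + a‖ ^ 2 := by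
    rw [div_mul_eq_mul_div, le_div_iff₀ hc0]
    linarith
  have h6 : ‖ξ.1.fst‖ ^ 2 ≤ K * ‖a‖ ^ 2 + K' * ‖pathConst ι ξ.1.fst‖ ^ 2 := by
    rw [PathL2.norm_sq_eq, PathL2.norm_sq_eq, PathL2.norm_sq_eq, ← integral_const_mul,
      ← integral_const_mul, ← integral_add ((PathL2.integrable_norm_sq _).const_mul _)
        ((PathL2.integrable_norm_sq _).const_mul _)]
    refine integral_mono_ae (PathL2.integrable_norm_sq _)
      (((PathL2.integrable_norm_sq _).const_mul _).add
        ((PathL2.integrable_norm_sq _).const_mul _)) ?_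
    filter_upwards [coeFn_pathConst A ξ.1.fst, coeFn_pathConst ι ξ.1.fst] with s h h'
    rw [ha, h, h']
    exact hell _
  nlinarith [sq_nonneg ‖d‖, sq_nonneg ‖a‖]

/-! ### Cut-offs -/

theorem memLp_smul_pathL2 {E : Type*} [NormedAddCommGroup E] [NormedSpace ℝ E] {χ : ℝ → ℝ}
    (hχ : Continuous χ) {M : ℝ} (hM : ∀ s, |χ s| ≤ M) (f : PathL2 E) :
    MemLp (fun s => χ s • f s) 2 (volume : Measure ℝ) :=
  (Lp.memLp f).of_le_mul (hχ.aestronglyMeasurable.smul (Lp.aestronglyMeasurable f))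
    (.of_forall fun s => by
      rw [norm_smul]
      exact mul_le_mul_of_nonneg_right (hM s) (norm_nonneg _))

theorem HasWeakDeriv.smul {E : Type*} [NormedAddCommGroup E] [NormedSpace ℝ E] {f g : PathL2 E}
    (h : HasWeakDeriv f g) {χ : ℝ → ℝ} (hχ : ContDiff ℝ ∞ χ) :
    HasWeakDeriv (fun s => χ s • f s) (fun s => deriv χ s • f s + χ s • g s) := by
  intro φ hφ hc
  have hχc := hχ.continuous
  have hχd : Continuous (deriv χ) := hχ.continuous_deriv (by simp)
  have hφd : Continuous (deriv φ) := hφ.continuous_deriv (by simp)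
  have i1 : Integrable (fun s => (φ s * deriv χ s) • f s) :=
    integrable_smul_pathL2 (hφ.continuous.mul hχd) hc.mul_right f
  have i2 : Integrable (fun s => (φ s * χ s) • g s) :=
    integrable_smul_pathL2 (hφ.continuous.mul hχc) hc.mul_right g
  have i3 : Integrable (fun s => (deriv φ s * χ s) • f s) :=
    integrable_smul_pathL2 (hφd.mul hχc) hc.deriv.mul_right f
  have key := h (fun s => φ s * χ s) (hφ.mul hχ) hc.mul_right
  have hder : ∀ s, deriv (fun s => φ s * χ s) s = deriv φ s * χ s + φ s * deriv χ s := fun s =>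
    deriv_fun_mul (hφ.differentiable (by simp) s) (hχ.differentiable (by simp) s)
  simp only [hder, add_smul] at key
  rw [integral_add i3 i1] at key
  simp only [smul_add, smul_smul]
  rw [integral_add i1 i2, neg_add, ← key]
  abel

theorem PathW.exists_smul {E₀ E₁ : Type*} [NormedAddCommGroup E₀] [NormedSpace ℝ E₀]
    [NormedAddCommGroup E₁] [NormedSpace ℝ E₁] {ι : E₁ →L[ℝ] E₀} (ξ : PathW ι) {χ : ℝ → ℝ}
    (hχ : ContDiff ℝ ∞ χ) {M M' : ℝ} (hM : ∀ s, |χ s| ≤ M) (hM' : ∀ s, |deriv χ s| ≤ M') :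
    ∃ ζ : PathW ι, (ζ.1.fst =ᵐ[volume] fun s => χ s • ξ.1.fst s) ∧
      (ζ.1.snd =ᵐ[volume] fun s => deriv χ s • ι (ξ.1.fst s) + χ s • ξ.1.snd s) := by
  have hχd : Continuous (deriv χ) := hχ.continuous_deriv (by simp)
  have m1 := memLp_smul_pathL2 hχ.continuous hM ξ.1.fst
  have m2 := (memLp_smul_pathL2 hχd hM' (pathConst ι ξ.1.fst)).add
    (memLp_smul_pathL2 hχ.continuous hM ξ.1.snd)
  have hw := (PathW.hasWeakDeriv ξ).smul hχ
  refine ⟨⟨WithLp.toLp 2 (m1.toLp _, m2.toLp _), ?_⟩, m1.coeFn_toLp, ?_⟩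
  · refine (hw.congr_left ?_).congr_right m2.coeFn_toLp.symm
    filter_upwards [m1.coeFn_toLp, coeFn_pathConst ι ξ.1.fst] with s h1 h2
    rw [h2, ← map_smul]
    exact congrArg ι h1.symm
  · refine m2.coeFn_toLp.trans ?_
    filter_upwards [coeFn_pathConst ι ξ.1.fst] with s h2
    simp only [Pi.add_apply]
    rw [h2]

theorem coeFn_pathOp {E₀ E₁ : Type*} [NormedAddCommGroup E₀] [NormedSpace ℝ E₀]
    [NormedAddCommGroup E₁] [NormedSpace ℝ E₁] (ι : E₁ →L[ℝ] E₀) (A : ℝ →ᵇ (E₁ →L[ℝ] E₀))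
    (ξ : PathW ι) :
    pathOp ι A ξ =ᵐ[volume] fun s => ξ.1.snd s + A s (ξ.1.fst s) := by
  have h : pathOp ι A ξ = ξ.1.snd + pathMul A ξ.1.fst := rfl
  rw [h]
  filter_upwards [Lp.coeFn_add ξ.1.snd (pathMul A ξ.1.fst), coeFn_pathMul A ξ.1.fst] with s h1 h2
  rw [h1, Pi.add_apply, h2]

theorem normOnIcc_sq {E₀ E₁ : Type*} [NormedAddCommGroup E₀] [NormedSpace ℝ E₀]
    [NormedAddCommGroup E₁] [NormedSpace ℝ E₁] {ι : E₁ →L[ℝ] E₀} (T : ℝ) (ξ : PathW ι) :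
    normOnIcc T ξ ^ 2 = ∫ s in Set.Icc (-T) T, ‖ι (ξ.1.fst s)‖ ^ 2 :=
  Real.sq_sqrt (integral_nonneg fun _ => by positivity)

theorem PathW.integrable_norm_sq {E₀ E₁ : Type*} [NormedAddCommGroup E₀] [NormedSpace ℝ E₀]
    [NormedAddCommGroup E₁] [NormedSpace ℝ E₁] {ι : E₁ →L[ℝ] E₀} (ξ : PathW ι) :
    Integrable (fun s => ‖ι (ξ.1.fst s)‖ ^ 2) := by
  refine (PathL2.integrable_norm_sq (pathConst ι ξ.1.fst)).congr ?_
  filter_upwards [coeFn_pathConst ι ξ.1.fst] with s h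
  rw [h]

theorem integral_cutoff_le_normOnIcc_sq {E₀ E₁ : Type*} [NormedAddCommGroup E₀] [NormedSpace ℝ E₀]
    [NormedAddCommGroup E₁] [NormedSpace ℝ E₁] {ι : E₁ →L[ℝ] E₀} (ξ : PathW ι) {χ : ℝ → ℝ} {M T : ℝ}
    (hM : ∀ s, |χ s| ≤ M) (hχ : ∀ s ∉ Set.Icc (-T) T, χ s = 0) :
    ∫ s, ‖χ s • ι (ξ.1.fst s)‖ ^ 2 ≤ M ^ 2 * normOnIcc T ξ ^ 2 := by
  rw [normOnIcc_sq, ← integral_indicator measurableSet_Icc, ← integral_const_mul]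
  refine integral_mono_of_nonneg (.of_forall fun s => by positivity)
    (((PathW.integrable_norm_sq ξ).indicator measurableSet_Icc).const_mul _)
    (.of_forall fun s => ?_)
  by_cases hs : s ∈ Set.Icc (-T) T
  · simp only [Set.indicator_of_mem hs]
    rw [norm_smul, mul_pow]
    gcongr
    exact hM s
  · simp [hχ s hs, Set.indicator_of_notMem hs]

theorem norm_add_three_sq_le {E : Type*} [SeminormedAddCommGroup E] (x y z : E) :
    ‖x + y + z‖ ^ 2 ≤ 3 * ‖x‖ ^ 2 + 3 * ‖y‖ ^ 2 + 3 * ‖z‖ ^ 2 := by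
  have h := norm_add₃_le (a := x) (b := y) (c := z)
  have h' : ‖x + y + z‖ ^ 2 ≤ (‖x‖ + ‖y‖ + ‖z‖) ^ 2 := by gcongr
  nlinarith [sq_nonneg (‖x‖ - ‖y‖), sq_nonneg (‖x‖ - ‖z‖), sq_nonneg (‖y‖ - ‖z‖)]

/-- The a priori estimate holds for the restriction of paths to the set `S`. -/
def SetEstimate {E₀ E₁ : Type*} [NormedAddCommGroup E₀] [NormedSpace ℝ E₀]
    [NormedAddCommGroup E₁] [NormedSpace ℝ E₁] (ι : E₁ →L[ℝ] E₀) (A : ℝ →ᵇ (E₁ →L[ℝ] E₀))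
    (S : Set ℝ) : Prop :=
  ∃ K ≥ 0, ∃ T > 0, ∀ ξ : PathW ι, (∫ s in S, ‖ξ.1.fst s‖ ^ 2) + (∫ s in S, ‖ξ.1.snd s‖ ^ 2) ≤
    K * (normOnIcc T ξ ^ 2 + ‖pathOp ι A ξ‖ ^ 2)

/-- The model estimate is applied to `ζ = χξ`. Only `χ'` must have bounded support if `C' = 0`,
since the term that sees `χ` itself is then absent; this alternative is what admits unbounded ends.
-/
theorem ModelEstimate.setEstimate {E₀ E₁ : Type*} [NormedAddCommGroup E₀] [NormedSpace ℝ E₀]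
    [NormedAddCommGroup E₁] [NormedSpace ℝ E₁] {ι A₀ : E₁ →L[ℝ] E₀} {C C' : ℝ}
    (h : ModelEstimate ι A₀ C C') (hC : 0 ≤ C) (hC' : 0 ≤ C') {A : ℝ →ᵇ (E₁ →L[ℝ] E₀)}
    {χ : ℝ → ℝ} (hχ : ContDiff ℝ ∞ χ) (hχ1 : ∀ s, |χ s| ≤ 1) {T : ℝ} (hT : 0 < T)
    (hχ' : ∀ s ∉ Set.Icc (-T) T, deriv χ s = 0)
    (hχT : C' = 0 ∨ ∀ s ∉ Set.Icc (-T) T, χ s = 0) {δ : ℝ}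
    (hδ : 6 * C * δ ^ 2 ≤ 1) (hA : ∀ s, χ s ≠ 0 → ‖A s - A₀‖ ≤ δ) {S : Set ℝ}
    (hS : MeasurableSet S) (hSχ : ∀ s ∈ S, χ s = 1) (hSχ' : ∀ s ∈ S, deriv χ s = 0) :
    SetEstimate ι A S := by
  have hχd : Continuous (deriv χ) := hχ.continuous_deriv (by simp)
  obtain ⟨M, hM⟩ := (isCompact_Icc (a := -T) (b := T)).exists_bound_of_continuousOn
    hχd.continuousOn
  have hM0 : 0 ≤ M := (norm_nonneg _).trans (hM 0 ⟨by linarith, by linarith⟩)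
  have hM' : ∀ s, |deriv χ s| ≤ M := fun s => by
    by_cases hs : s ∈ Set.Icc (-T) T
    · exact hM s hs
    · simpa [hχ' s hs] using hM0
  -- The three-term square inequality gives factors `3 * C`. The choice of `δ` makes the
  -- perturbation at most half of `‖ζ‖²`, and absorbing it doubles the constants.
  refine ⟨6 * C + 6 * C * M ^ 2 + 2 * C', by positivity, T, hT, fun ξ => ?_⟩
  obtain ⟨ζ, h1, h2⟩ := PathW.exists_smul ξ hχ hχ1 hM'
  have e0 := h ζ
  set N := normOnIcc T ξ ^ 2
  have hN : 0 ≤ N := by positivity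
  have e1 : ‖ζ.1.snd + pathConst A₀ ζ.1.fst‖ ^ 2 ≤
      3 * ‖pathOp ι A ξ‖ ^ 2 + 3 * (M ^ 2 * N) + 3 * (δ ^ 2 * ‖ζ.1.fst‖ ^ 2) := by
    have f1 := integral_cutoff_le_normOnIcc_sq ξ hM' hχ'
    have i1 := (PathL2.integrable_norm_sq (pathOp ι A ξ)).const_mul 3
    have i2 : Integrable (fun s => ‖deriv χ s • ι (ξ.1.fst s)‖ ^ 2) := by
      refine ((memLp_smul_pathL2 hχd hM' (pathConst ι ξ.1.fst)).integrable_norm_pow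
        two_ne_zero).congr ?_
      filter_upwards [coeFn_pathConst ι ξ.1.fst] with s h
      rw [h]
    have i3 := ((PathL2.integrable_norm_sq ζ.1.fst).const_mul (δ ^ 2)).const_mul 3
    have i4 : Integrable (fun s => 3 * ‖pathOp ι A ξ s‖ ^ 2 + 3 * ‖deriv χ s • ι (ξ.1.fst s)‖ ^ 2) :=
      i1.add (i2.const_mul 3)
    refine le_trans ?_ (add_le_add_left (add_le_add_right (mul_le_mul_of_nonneg_left f1
      (by norm_num : (0 : ℝ) ≤ 3)) _) _)
    rw [PathL2.norm_sq_eq, PathL2.norm_sq_eq, PathL2.norm_sq_eq, ← integral_const_mul,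
      ← integral_const_mul, ← integral_const_mul, ← integral_const_mul,
      ← integral_add i1 (i2.const_mul 3), ← integral_add i4 i3]
    refine integral_mono_ae (PathL2.integrable_norm_sq _) (i4.add i3) ?_
    filter_upwards [h1, h2, coeFn_pathOp ι A ξ, coeFn_pathConst A₀ ζ.1.fst,
      Lp.coeFn_add ζ.1.snd (pathConst A₀ ζ.1.fst)] with s g1 g2 g3 g4 g5
    -- The frozen operator on `χξ` is the cut-off of `D_A ξ`, plus the commutator `χ' ιξ`, minus the
    -- freezing error.
    have e : (ζ.1.snd + pathConst A₀ ζ.1.fst : PathL2 E₀) s = χ s • pathOp ι A ξ s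
        + deriv χ s • ι (ξ.1.fst s) - (A s - A₀) (ζ.1.fst s) := by
      rw [g5, Pi.add_apply, g4, g2, g3, g1, map_smul, map_smul, sub_apply, smul_add, smul_sub]
      abel
    rw [e, sub_eq_add_neg]
    refine (norm_add_three_sq_le _ _ _).trans ?_
    rw [norm_neg]
    gcongr
    · rw [norm_smul]
      exact mul_le_of_le_one_left (norm_nonneg _) (hχ1 s)
    · rw [← mul_pow]
      refine pow_le_pow_left₀ (norm_nonneg _) ?_ 2
      by_cases hs : χ s = 0
      · simp [g1, hs]
      · exact (A s - A₀).le_of_opNorm_le (hA s hs) _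
  have e2 : C' * ‖pathConst ι ζ.1.fst‖ ^ 2 ≤ C' * N := by
    rcases hχT with rfl | hχT
    · simp
    gcongr
    have := integral_cutoff_le_normOnIcc_sq ξ hχ1 hχT
    rw [one_pow, one_mul] at this
    refine le_trans (le_of_eq ?_) this
    rw [PathL2.norm_sq_eq]
    refine integral_congr_ae ?_
    filter_upwards [h1, coeFn_pathConst ι ζ.1.fst] with s g1 g2
    rw [g2, g1, map_smul]
  have e3 : ∫ s in S, ‖ξ.1.fst s‖ ^ 2 ≤ ‖ζ.1.fst‖ ^ 2 := by
    rw [PathL2.norm_sq_eq]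
    refine le_trans (le_of_eq ?_) (setIntegral_le_integral (s := S)
      (PathL2.integrable_norm_sq ζ.1.fst) (.of_forall fun s => by positivity))
    refine setIntegral_congr_ae hS ?_
    filter_upwards [h1] with s g1 hs
    rw [g1, hSχ s hs, one_smul]
  have e4 : ∫ s in S, ‖ξ.1.snd s‖ ^ 2 ≤ ‖ζ.1.snd‖ ^ 2 := by
    rw [PathL2.norm_sq_eq]
    refine le_trans (le_of_eq ?_) (setIntegral_le_integral (s := S)
      (PathL2.integrable_norm_sq ζ.1.snd) (.of_forall fun s => by positivity))
    refine setIntegral_congr_ae hS ?_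
    filter_upwards [h2] with s g2 hs
    rw [g2, hSχ s hs, hSχ' s hs, one_smul, zero_smul, zero_add]
  have e5 := mul_le_mul_of_nonneg_left e1 hC
  have e6 := mul_le_mul_of_nonneg_right hδ (sq_nonneg ‖ζ.1.fst‖)
  have e7 : 0 ≤ 6 * C * M ^ 2 * ‖pathOp ι A ξ‖ ^ 2 := by positivity
  have e8 : 0 ≤ 2 * C' * ‖pathOp ι A ξ‖ ^ 2 := by positivity
  have e9 : 0 ≤ 6 * C * N := by positivity
  have e10 := sq_nonneg ‖ζ.1.snd‖
  nlinarith

/-! ### From local to global estimates -/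

section SetEstimate

variable {E₀ E₁ : Type*} [NormedAddCommGroup E₀] [NormedSpace ℝ E₀]
    [NormedAddCommGroup E₁] [NormedSpace ℝ E₁] {ι : E₁ →L[ℝ] E₀} {A : ℝ →ᵇ (E₁ →L[ℝ] E₀)}
    {S S' : Set ℝ}

theorem SetEstimate.mono (h : SetEstimate ι A S) (hS : S' ⊆ S) : SetEstimate ι A S' := by
  obtain ⟨K, hK, T, hT, h⟩ := h
  refine ⟨K, hK, T, hT, fun ξ => (add_le_add ?_ ?_).trans (h ξ)⟩
  · exact setIntegral_mono_set (PathL2.integrable_norm_sq _).integrableOn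
      (.of_forall fun s => by positivity) hS.eventuallyLE
  · exact setIntegral_mono_set (PathL2.integrable_norm_sq _).integrableOn
      (.of_forall fun s => by positivity) hS.eventuallyLE

theorem normOnIcc_sq_mono {T T' : ℝ} (h : T ≤ T') (ξ : PathW ι) :
    normOnIcc T ξ ^ 2 ≤ normOnIcc T' ξ ^ 2 := by
  rw [normOnIcc_sq, normOnIcc_sq]
  exact setIntegral_mono_set (PathW.integrable_norm_sq ξ).integrableOn
      (.of_forall fun s => by positivity) (Set.Icc_subset_Icc (by linarith) h).eventuallyLE

theorem SetEstimate.union (h : SetEstimate ι A S) (h' : SetEstimate ι A S') :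
    SetEstimate ι A (S ∪ S') := by
  obtain ⟨K, hK, T, hT, h⟩ := h
  obtain ⟨K', hK', T', hT', h'⟩ := h'
  refine ⟨K + K', by positivity, max T T', by positivity, fun ξ => ?_⟩
  have hu : ∀ g : ℝ → ℝ, Integrable g → (∀ s, 0 ≤ g s) →
      ∫ s in S ∪ S', g s ≤ (∫ s in S, g s) + ∫ s in S', g s := by
    intro g hg h0
    rw [← integral_add_measure hg.restrict hg.restrict]
    exact integral_mono_measure (Measure.restrict_union_le _ _) (.of_forall h0)
      (hg.restrict.add_measure hg.restrict)
  have h1 := hu _ (PathL2.integrable_norm_sq ξ.1.fst) fun _ => by positivity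
  have h2 := hu _ (PathL2.integrable_norm_sq ξ.1.snd) fun _ => by positivity
  have h3 := h ξ
  have h4 := h' ξ
  have h5 := mul_le_mul_of_nonneg_left (normOnIcc_sq_mono (le_max_left T T') ξ) hK
  have h6 := mul_le_mul_of_nonneg_left (normOnIcc_sq_mono (le_max_right T T') ξ) hK'
  linarith

theorem SetEstimate.empty : SetEstimate ι A ∅ :=
  ⟨0, le_rfl, 1, one_pos, fun ξ => by simp⟩

theorem SetEstimate.of_isCompact {s : Set ℝ} (hs : IsCompact s)
    (h : ∀ t, ∃ C ≥ 0, ∃ C' ≥ 0, ModelEstimate ι (A t) C C') : SetEstimate ι A s := by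
  refine hs.induction_on SetEstimate.empty (fun _ _ hst ht => ht.mono hst)
    (fun _ _ => SetEstimate.union) fun t _ => ?_
  obtain ⟨C, hC, C', hC', hm⟩ := h t
  -- The tolerance `δ = (6 * C + 1)⁻¹` satisfies `6 * C * δ ^ 2 ≤ 1` without excluding `C = 0`.
  obtain ⟨ε, hε, hb⟩ := Metric.continuousAt_iff.1 A.continuous.continuousAt (6 * C + 1)⁻¹
    (by positivity : 0 < (6 * C + 1)⁻¹)
  let χ : ContDiffBump t := ⟨ε / 2, ε, by positivity, by linarith⟩
  have hball : ∀ s, s ∉ Set.Icc (-(|t| + ε)) (|t| + ε) → s ∉ Metric.closedBall t ε := by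
    intro s hs hs'
    rw [Metric.mem_closedBall, Real.dist_eq, abs_le] at hs'
    exact hs ⟨by linarith [neg_abs_le t], by linarith [le_abs_self t]⟩
  have hball' : ∀ s, s ∉ Set.Icc (-(|t| + ε)) (|t| + ε) → s ∉ tsupport χ := by
    intro s hs
    rw [χ.tsupport_eq]
    exact hball s hs
  refine ⟨Metric.ball t (ε / 2), mem_nhdsWithin_of_mem_nhds (Metric.ball_mem_nhds _ (by positivity)),
    hm.setEstimate hC hC' (χ := χ) χ.contDiff ?_ (T := |t| + ε) (by positivity) ?_ (.inr ?_)
      (δ := (6 * C + 1)⁻¹) ?_ ?_ measurableSet_ball ?_ ?_⟩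
  · intro s
    rw [abs_of_nonneg χ.nonneg]
    exact χ.le_one
  · intro s hs
    exact image_eq_zero_of_notMem_tsupport fun hs' => hball' s hs (tsupport_deriv_subset hs')
  · exact fun s hs => image_eq_zero_of_notMem_tsupport (hball' s hs)
  · rw [inv_pow, ← div_eq_mul_inv, div_le_one (by positivity)]
    nlinarith
  · intro s hs
    have hs' : s ∈ Metric.ball t ε := by
      rw [← show Function.support χ = Metric.ball t ε from χ.support_eq]
      exact hs
    rw [← dist_eq_norm]
    exact (hb hs').le
  · exact fun s hs => χ.one_of_mem_closedBall (Metric.ball_subset_closedBall hs)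
  · intro s hs
    have : χ =ᶠ[𝓝 s] fun _ => (1 : ℝ) := by
      filter_upwards [Metric.isOpen_ball.mem_nhds hs] with u hu
      exact χ.one_of_mem_closedBall (Metric.ball_subset_closedBall hu)
    rw [this.deriv_eq, deriv_const]

theorem deriv_smoothTransition_of_notMem {s : ℝ} (h : s ∉ Set.Icc (0 : ℝ) 1) :
    deriv Real.smoothTransition s = 0 := by
  rw [Set.mem_Icc, not_and_or, not_le, not_le] at h
  rcases h with h | h
  · have : Real.smoothTransition =ᶠ[𝓝 s] fun _ => (0 : ℝ) := by
      filter_upwards [Iio_mem_nhds h] with u hu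
      exact Real.smoothTransition.zero_of_nonpos (le_of_lt hu)
    rw [this.deriv_eq, deriv_const]
  · have : Real.smoothTransition =ᶠ[𝓝 s] fun _ => (1 : ℝ) := by
      filter_upwards [Ioi_mem_nhds h] with u hu
      exact Real.smoothTransition.one_of_one_le (le_of_lt hu)
    rw [this.deriv_eq, deriv_const]

/-- The slope `a = ±1` covers both ends at once. The cut-off varies only where `0 ≤ a * s + b ≤ 1`,
hence for `|s| ≤ |b| + 1`, so its commutator is seen by a bounded interval although the cut-off
itself has unbounded support. -/
theorem SetEstimate.of_end {A' : E₁ →L[ℝ] E₀} {C a b R : ℝ} (hC : 0 ≤ C)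
    (h : ModelEstimate ι A' C 0) (ha : a ^ 2 = 1)
    (hR : ∀ s, 0 < a * s + b → ‖A s - A'‖ ≤ (6 * C + 1)⁻¹) (hb : R = |b| + 1) :
    SetEstimate ι A {s | 1 < a * s + b} := by
  have ha' : |a| = 1 := by
    rw [← sq_eq_sq₀ (abs_nonneg a) zero_le_one, sq_abs, ha, one_pow]
  have hd : ∀ s, deriv (fun s => Real.smoothTransition (a * s + b)) s
      = deriv Real.smoothTransition (a * s + b) * a := fun s =>
    (((Real.smoothTransition.contDiff (n := 1)).differentiable (by simp) _).hasDerivAt.comp s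
      (((hasDerivAt_id s).const_mul a).add_const b)).deriv.trans (by simp)
  refine h.setEstimate hC le_rfl (χ := fun s => Real.smoothTransition (a * s + b)) ?_ ?_
      (T := R) (by rw [hb]; positivity) ?_ (.inl rfl) (δ := (6 * C + 1)⁻¹) ?_ ?_ ?_ ?_ ?_
  · exact Real.smoothTransition.contDiff.comp ((contDiff_const.mul contDiff_id).add contDiff_const)
  · intro s
    rw [abs_of_nonneg (Real.smoothTransition.nonneg _)]
    exact Real.smoothTransition.le_one _
  · intro s hs
    rw [hd, deriv_smoothTransition_of_notMem, zero_mul]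
    rintro ⟨h0, h1⟩
    refine hs (abs_le.1 ?_)
    calc |s| = |a * s + b + -b| := by rw [add_neg_cancel_right, abs_mul, ha', one_mul]
      _ ≤ |a * s + b| + |-b| := abs_add_le _ _
      _ ≤ R := by rw [abs_neg, abs_of_nonneg h0, hb]; linarith
  · rw [inv_pow, ← div_eq_mul_inv, div_le_one (by positivity)]
    nlinarith
  · intro s hs
    refine hR s ?_
    by_contra hcon
    exact hs (Real.smoothTransition.zero_of_nonpos (not_lt.1 hcon))
  · exact measurableSet_lt measurable_const (by fun_prop)
  · exact fun s hs => Real.smoothTransition.one_of_one_le (le_of_lt hs)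
  · intro s hs
    rw [hd, deriv_smoothTransition_of_notMem (fun h => not_lt.2 h.2 hs), zero_mul]

theorem PathW.norm_sq_eq (ξ : PathW ι) : ‖ξ‖ ^ 2 = ‖ξ.1.fst‖ ^ 2 + ‖ξ.1.snd‖ ^ 2 :=
  WithLp.prod_norm_sq_eq_of_L2 ξ.1

theorem exists_global_estimate (h : ∀ t, ∃ C ≥ 0, ∃ C' ≥ 0, ModelEstimate ι (A t) C C')
    (htop : ∃ A', (∃ C ≥ 0, ModelEstimate ι A' C 0) ∧ Tendsto A atTop (𝓝 A'))
    (hbot : ∃ A', (∃ C ≥ 0, ModelEstimate ι A' C 0) ∧ Tendsto A atBot (𝓝 A')) :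
    ∃ c > 0, ∃ T > 0, ∀ ξ : PathW ι, ‖ξ‖ ≤ c * (normOnIcc T ξ + ‖pathOp ι A ξ‖) := by
  obtain ⟨Ap, ⟨Cp, hCp, mp⟩, hp⟩ := htop
  obtain ⟨Am, ⟨Cm, hCm, mm⟩, hm⟩ := hbot
  obtain ⟨b, hb⟩ := eventually_atTop.1 (Metric.tendsto_nhds.1 hp (6 * Cp + 1)⁻¹ (by positivity))
  obtain ⟨a, ha⟩ := eventually_atBot.1 (Metric.tendsto_nhds.1 hm (6 * Cm + 1)⁻¹ (by positivity))
  have h1 : SetEstimate ι A {s | 1 < 1 * s + -b} := by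
    refine SetEstimate.of_end hCp mp (by norm_num) (fun s hs => ?_) rfl
    rw [← dist_eq_norm]
    exact (hb s (by linarith)).le
  have h2 : SetEstimate ι A {s | 1 < -1 * s + a} := by
    refine SetEstimate.of_end hCm mm (by norm_num) (fun s hs => ?_) rfl
    rw [← dist_eq_norm]
    exact (ha s (by linarith)).le
  have h3 := SetEstimate.of_isCompact (isCompact_Icc (a := a - 1) (b := b + 1)) h
  obtain ⟨K, hK, T, hT, he⟩ := ((h1.union h2).union h3).mono (S' := Set.univ) (by
    intro s _
    by_cases c1 : b + 1 < s
    · exact .inl (.inl (show 1 < 1 * s + -b by linarith))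
    by_cases c2 : s < a - 1
    · exact .inl (.inr (show 1 < -1 * s + a by linarith))
    exact .inr ⟨not_lt.1 c2, not_lt.1 c1⟩)
  -- Adding one keeps the constant positive when `K = 0`, and its square still dominates `K`.
  refine ⟨√K + 1, by positivity, T, hT, fun ξ => ?_⟩
  have hn : 0 ≤ normOnIcc T ξ := Real.sqrt_nonneg _
  refine le_of_sq_le_sq ?_ (by positivity)
  have h4 := he ξ
  rw [setIntegral_univ, setIntegral_univ, ← PathL2.norm_sq_eq, ← PathL2.norm_sq_eq,
    ← PathW.norm_sq_eq] at h4
  refine h4.trans ?_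
  rw [mul_pow]
  refine mul_le_mul ?_ ?_ (by positivity) (by positivity)
  · nlinarith [Real.sq_sqrt hK, Real.sqrt_nonneg K]
  · nlinarith [norm_nonneg (pathOp ι A ξ)]

end SetEstimate

/-! ### Symmetrizable Fredholm operators -/

/-- The given bounds concern the diagonal only; Cauchy–Schwarz for `B` turns them into a joint
bound. -/
theorem IsEquivInner.exists_continuous {H : Type*} [NormedAddCommGroup H] [InnerProductSpace ℝ H]
    {B : LinearMap.BilinForm ℝ H} (hB : IsEquivInner B) :
    ∃ b : H →L[ℝ] H →L[ℝ] ℝ, (∀ x y, b x y = B x y) ∧ (∀ x y, b x y = b y x) ∧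
      ∃ c > 0, ∀ x, c * ‖x‖ ^ 2 ≤ b x x := by
  obtain ⟨hsym, c, hc, hcB⟩ := hB
  have h0 : ∀ x, 0 ≤ B x x := by
    intro x
    by_cases hx : x = 0
    · simp [hx]
    · exact (Real.sqrt_pos.1 (lt_of_lt_of_le (by positivity) (hcB x).1)).le
  have hup : ∀ x, B x x ≤ c ^ 2 * ‖x‖ ^ 2 := fun x => by
    rw [← Real.sq_sqrt (h0 x), ← mul_pow]
    exact pow_le_pow_left₀ (Real.sqrt_nonneg _) (hcB x).2 2
  have hlow : ∀ x, (c⁻¹) ^ 2 * ‖x‖ ^ 2 ≤ B x x := fun x => by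
    rw [← Real.sq_sqrt (h0 x), ← mul_pow]
    exact pow_le_pow_left₀ (by positivity) (hcB x).1 2
  have hbd : ∀ x y, ‖B x y‖ ≤ c ^ 2 * ‖x‖ * ‖y‖ := fun x y => by
    refine abs_le_of_sq_le_sq ?_ (by positivity)
    have h1 := LinearMap.BilinForm.apply_mul_apply_le_of_forall_zero_le B h0 x y
    rw [hsym y x] at h1
    calc B x y ^ 2 = B x y * B x y := sq _
      _ ≤ B x x * B y y := h1
      _ ≤ (c ^ 2 * ‖x‖ ^ 2) * (c ^ 2 * ‖y‖ ^ 2) :=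
        mul_le_mul (hup x) (hup y) (h0 y) (by positivity)
      _ = (c ^ 2 * ‖x‖ * ‖y‖) ^ 2 := by ring
  exact ⟨LinearMap.mkContinuous₂ B (c ^ 2) hbd, fun x y => rfl, hsym, (c⁻¹) ^ 2, by positivity,
    hlow⟩

theorem IsHessian.exists_form {H₀ H₁ : Type*} [NormedAddCommGroup H₀] [InnerProductSpace ℝ H₀]
    [NormedAddCommGroup H₁] [InnerProductSpace ℝ H₁] {ι A : H₁ →L[ℝ] H₀} (h : IsHessian ι A) :
    ∃ b : H₀ →L[ℝ] H₀ →L[ℝ] ℝ, (∀ x y, b x y = b y x) ∧ (∃ c > 0, ∀ x, c * ‖x‖ ^ 2 ≤ b x x) ∧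
      ∀ x y, b (A x) (ι y) = b (ι x) (A y) := by
  obtain ⟨B, hB, hA⟩ := h.symmetrizable
  obtain ⟨b, hb, hsym, hc⟩ := hB.exists_continuous
  exact ⟨b, hsym, hc, by simpa only [hb] using hA⟩

theorem eq_zero_of_form_self_eq_zero {H : Type*} [NormedAddCommGroup H] [NormedSpace ℝ H]
    {b : H →L[ℝ] H →L[ℝ] ℝ} (hc : ∃ c > 0, ∀ x, c * ‖x‖ ^ 2 ≤ b x x) {x : H} (hx : b x x = 0) :
    x = 0 := by
  obtain ⟨c, hc0, hc⟩ := hc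
  have h := hc x
  rw [hx] at h
  by_contra hne
  have : 0 < c * ‖x‖ ^ 2 := by positivity
  linarith

/-- By symmetry the image of the kernel under `ι` is `b`-orthogonal to the range, so the kernel
injects into the cokernel. Index zero makes the dimensions equal, and the injection is onto. -/
theorem IsHessian.exists_eq_add {H₀ H₁ : Type*} [NormedAddCommGroup H₀] [InnerProductSpace ℝ H₀]
    [NormedAddCommGroup H₁] [InnerProductSpace ℝ H₁] {ι A : H₁ →L[ℝ] H₀} (h : IsHessian ι A)
    (hι : Function.Injective ι) (v : H₀) : ∃ x k, A k = 0 ∧ v = A x + ι k := by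
  obtain ⟨b, hsym, hc, hA⟩ := h.exists_form
  have := h.fredholm.finite_ker
  have := h.fredholm.finite_coker
  let φ : A.ker →ₗ[ℝ] H₀ ⧸ A.range := A.range.mkQ ∘ₗ ι.toLinearMap ∘ₗ A.ker.subtype
  have hφ : Function.Injective φ := by
    rw [injective_iff_map_eq_zero]
    rintro ⟨k, hk⟩ h0
    have hk' : A k = 0 := hk
    obtain ⟨x, hx⟩ : ∃ x, A x = ι k := (Submodule.Quotient.mk_eq_zero _).1 h0
    have h1 : b (ι k) (ι k) = 0 := by
      nth_rewrite 2 [← hx]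
      rw [← hA, hk']
      simp
    exact Subtype.ext (hι (by simpa using eq_zero_of_form_self_eq_zero hc h1))
  have hrank : Module.finrank ℝ A.ker = Module.finrank ℝ (H₀ ⧸ A.range) := by
    have := h.index_eq_zero
    rw [LinearMap.index_eq_finrank_sub] at this
    exact_mod_cast sub_eq_zero.1 this
  obtain ⟨⟨k, hk⟩, hkv⟩ :=
    (LinearMap.injective_iff_surjective_of_finrank_eq_finrank hrank).1 hφ (A.range.mkQ v)
  obtain ⟨x, hx⟩ : ∃ x, A x = v - ι k := (Submodule.Quotient.eq A.range).1 hkv.symm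
  exact ⟨x, k, hk, by rw [hx, sub_add_cancel]⟩

/-- A Hessian is self-adjoint for its inner product. -/
theorem IsHessian.exists_of_forall_form_eq {H₀ H₁ : Type*} [NormedAddCommGroup H₀]
    [InnerProductSpace ℝ H₀] [NormedAddCommGroup H₁] [InnerProductSpace ℝ H₁] {ι A : H₁ →L[ℝ] H₀}
    (h : IsHessian ι A) (hι : Function.Injective ι) {b : H₀ →L[ℝ] H₀ →L[ℝ] ℝ}
    (hc : ∃ c > 0, ∀ x, c * ‖x‖ ^ 2 ≤ b x x)
    (hA : ∀ x y, b (A x) (ι y) = b (ι x) (A y)) {w v : H₀}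
    (hwv : ∀ y, b w (A y) = b v (ι y)) : ∃ u, ι u = w ∧ A u = v := by
  obtain ⟨z, k, hk, hv⟩ := h.exists_eq_add hι v
  -- Testing the hypothesis at `k` leaves only `b (ι k) (ι k)`.
  have h1 : ι k = 0 := by
    refine eq_zero_of_form_self_eq_zero hc ?_
    have e := hwv k
    rw [hk, map_zero, hv, map_add, _root_.add_apply, hA, hk, map_zero, zero_add] at e
    exact e.symm
  rw [h1, add_zero] at hv
  have h2 : ∀ y, b (w - ι z) (A y) = 0 := by
    intro y
    rw [map_sub, sub_apply, hwv, hv, hA, sub_self]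
  -- The vector `w - ι z` is orthogonal to the range, so its range component `A p` vanishes and only
  -- a kernel element `q` corrects `z`.
  obtain ⟨p, q, hq, hpq⟩ := h.exists_eq_add hι (w - ι z)
  have h3 : A p = 0 := by
    refine eq_zero_of_form_self_eq_zero hc ?_
    have e := h2 p
    rw [hpq, map_add, _root_.add_apply, ← hA, hq, map_zero, zero_apply, add_zero] at e
    exact e
  refine ⟨z + q, ?_, ?_⟩
  · rw [map_add, ← zero_add (ι q), ← h3, ← hpq, add_sub_cancel]
  · rw [map_add, hq, add_zero, hv]

theorem exists_sq_le_of_le_add {p q r : ℝ} {a b : ℝ} (hp : 0 ≤ p) (h : p ≤ a * q + b * r) :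
    p ^ 2 ≤ 2 * a ^ 2 * q ^ 2 + 2 * b ^ 2 * r ^ 2 := by
  have : p ^ 2 ≤ (a * q + b * r) ^ 2 := pow_le_pow_left₀ hp h 2
  nlinarith [sq_nonneg (a * q - b * r)]

/-- Closed range and the open mapping theorem give a preimage of `A x` of controlled norm. It
differs from `x` by an element of the finite dimensional kernel, on which the injective `ι` is
bounded below. -/
theorem ContinuousLinearMap.IsFredholm.exists_elliptic {H₀ H₁ : Type*} [NormedAddCommGroup H₀]
    [NormedSpace ℝ H₀] [CompleteSpace H₀] [NormedAddCommGroup H₁] [NormedSpace ℝ H₁]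
    [CompleteSpace H₁] {ι A : H₁ →L[ℝ] H₀} (h : A.IsFredholm) (hι : Function.Injective ι) :
    ∃ K ≥ 0, ∃ K' ≥ 0, ∀ x, ‖x‖ ^ 2 ≤ K * ‖A x‖ ^ 2 + K' * ‖ι x‖ ^ 2 := by
  have := h.finite_ker
  have : CompleteSpace A.range := h.isClosed_range.completeSpace_coe
  let A' : H₁ →L[ℝ] A.range := A.codRestrict A.range (fun x => ⟨x, rfl⟩)
  have hA' : Function.Surjective A' := by
    rintro ⟨_, x, rfl⟩
    exact ⟨x, rfl⟩
  obtain ⟨C, hC, hpre⟩ := A'.exists_preimage_norm_le hA'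
  have hinj : (ι.toLinearMap ∘ₗ A.ker.subtype).ker = ⊥ :=
    LinearMap.ker_eq_bot.2 (hι.comp Subtype.val_injective)
  obtain ⟨K, hK, hanti⟩ := LinearMap.exists_antilipschitzWith _ hinj
  refine ⟨2 * (C + K * (‖ι‖ * C)) ^ 2, by positivity, 2 * (K : ℝ) ^ 2, by positivity, fun x => ?_⟩
  refine exists_sq_le_of_le_add (norm_nonneg _) ?_
  obtain ⟨x', hx', hxn⟩ := hpre (A' x)
  have hx'' : A x' = A x := congrArg Subtype.val hx'
  have hxn' : ‖x'‖ ≤ C * ‖A x‖ := hxn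
  have hk : x - x' ∈ A.ker := by
    change A (x - x') = 0
    rw [map_sub, hx'', sub_self]
  have h1 : ‖x - x'‖ ≤ K * ‖ι (x - x')‖ := by
    have := hanti.le_mul_dist ⟨x - x', hk⟩ 0
    simpa [dist_eq_norm] using this
  have h2 : ‖ι (x - x')‖ ≤ ‖ι x‖ + ‖ι‖ * (C * ‖A x‖) := by
    rw [map_sub]
    refine (norm_sub_le _ _).trans ?_
    gcongr
    exact ι.le_opNorm_of_le hxn'
  calc ‖x‖ = ‖x' + (x - x')‖ := by rw [add_sub_cancel]
    _ ≤ C * ‖A x‖ + K * (‖ι x‖ + ‖ι‖ * (C * ‖A x‖)) :=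
      (norm_add_le _ _).trans (add_le_add hxn' (h1.trans (by gcongr)))
    _ = _ := by ring

theorem IsHessian.exists_modelEstimate {H₀ H₁ : Type*} [NormedAddCommGroup H₀]
    [InnerProductSpace ℝ H₀] [CompleteSpace H₀] [NormedAddCommGroup H₁] [InnerProductSpace ℝ H₁]
    [CompleteSpace H₁] {ι A : H₁ →L[ℝ] H₀} (h : IsHessian ι A) (hι : Function.Injective ι) :
    ∃ C ≥ 0, ∃ C' ≥ 0, ModelEstimate ι A C C' := by
  obtain ⟨b, hsym, ⟨c, hc0, hc⟩, hA⟩ := h.exists_form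
  obtain ⟨K, hK, K', hK', hell⟩ := h.fredholm.exists_elliptic hι
  exact ⟨_, by positivity, K', hK', modelEstimate_of_symm hsym hc0 hc hA hK hell⟩

theorem IsHessian.exists_modelEstimate_of_isInvertible {H₀ H₁ : Type*} [NormedAddCommGroup H₀]
    [InnerProductSpace ℝ H₀] [CompleteSpace H₀] [NormedAddCommGroup H₁] [InnerProductSpace ℝ H₁]
    {ι A : H₁ →L[ℝ] H₀} (h : IsHessian ι A) (hinv : A.IsInvertible) :
    ∃ C ≥ 0, ModelEstimate ι A C 0 := by
  obtain ⟨b, hsym, ⟨c, hc0, hc⟩, hA⟩ := h.exists_form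
  obtain ⟨e, rfl⟩ := hinv
  refine ⟨_, ?_, modelEstimate_of_symm hsym hc0 hc hA (sq_nonneg ‖(e.symm : H₀ →L[ℝ] H₁)‖)
    (K' := 0) fun x => ?_⟩
  · positivity
  · rw [zero_mul, add_zero, ← mul_pow]
    refine pow_le_pow_left₀ (norm_nonneg _) ?_ 2
    simpa using (e.symm : H₀ →L[ℝ] H₁).le_opNorm (e x)

/-! ### The adjoint operators -/

theorem banachAdjoint_apply_apply {E₀ E₁ : Type*} [NormedAddCommGroup E₀] [NormedSpace ℝ E₀]
    [NormedAddCommGroup E₁] [NormedSpace ℝ E₁] (A : E₁ →L[ℝ] E₀) (η : StrongDual ℝ E₀) (x : E₁) :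
    banachAdjoint A η x = η (A x) := rfl

/-- The Lax-Milgram theorem: a coercive form identifies a Hilbert space with its dual. -/
theorem exists_equiv_dual_of_coercive {H : Type*} [NormedAddCommGroup H] [InnerProductSpace ℝ H]
    [CompleteSpace H] {b : H →L[ℝ] H →L[ℝ] ℝ} (hc : ∃ c > 0, ∀ x, c * ‖x‖ ^ 2 ≤ b x x) :
    ∃ e : H ≃L[ℝ] StrongDual ℝ H, ∀ x, e x = b x := by
  obtain ⟨c, hc0, hc'⟩ := hc
  have hco : IsCoercive b := ⟨c, hc0, fun x => by rw [mul_assoc, ← sq]; exact hc' x⟩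
  have hinj : Function.Injective b := by
    rw [injective_iff_map_eq_zero]
    intro x hx
    exact eq_zero_of_form_self_eq_zero ⟨c, hc0, hc'⟩ (by rw [hx]; rfl)
  have hsurj : Function.Surjective b := by
    intro φ
    obtain ⟨v, rfl⟩ := (InnerProductSpace.toDual ℝ H).surjective φ
    refine ⟨hco.continuousLinearEquivOfBilin.symm v, ContinuousLinearMap.ext fun y => ?_⟩
    rw [← hco.continuousLinearEquivOfBilin_apply, ContinuousLinearEquiv.apply_symm_apply]
    rfl
  exact ⟨ContinuousLinearEquiv.ofBijective b (LinearMap.ker_eq_bot.2 hinj)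
    (LinearMap.range_eq_top.2 hsurj), fun x => rfl⟩

/-- The graph form `g` is coercive by the elliptic bound, hence identifies `H₁` with its dual
through `e`; `β` is `g` transported by `e`. Symmetry of `-A*` for `β` rests on self-adjointness of
`A`, not merely on its symmetry. -/
theorem IsHessian.exists_form_dual {H₀ H₁ : Type*} [NormedAddCommGroup H₀]
    [InnerProductSpace ℝ H₀] [CompleteSpace H₀] [NormedAddCommGroup H₁] [InnerProductSpace ℝ H₁]
    [CompleteSpace H₁] {ι A : H₁ →L[ℝ] H₀} (h : IsHessian ι A) (hι : Function.Injective ι) :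
    ∃ β : StrongDual ℝ H₁ →L[ℝ] StrongDual ℝ H₁ →L[ℝ] ℝ, (∀ φ ψ, β φ ψ = β ψ φ) ∧
      (∃ c > 0, ∀ φ, c * ‖φ‖ ^ 2 ≤ β φ φ) ∧
      ∀ η θ, β (-banachAdjoint A η) (banachAdjoint ι θ)
        = β (banachAdjoint ι η) (-banachAdjoint A θ) := by
  obtain ⟨b, hsym, hc, hA⟩ := h.exists_form
  obtain ⟨K, hK, K', hK', hell⟩ := h.fredholm.exists_elliptic hι
  obtain ⟨e₀, he₀⟩ := exists_equiv_dual_of_coercive hc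
  let g : H₁ →L[ℝ] H₁ →L[ℝ] ℝ := b.bilinearComp A A + b.bilinearComp ι ι
  have hg : ∀ x y, g x y = b (A x) (A y) + b (ι x) (ι y) := fun x y => rfl
  have hgsym : ∀ x y, g x y = g y x := fun x y => by rw [hg, hg, hsym, hsym (ι x)]
  have hgc : ∃ c > 0, ∀ x, c * ‖x‖ ^ 2 ≤ g x x := by
    obtain ⟨c, hc0, hc⟩ := hc
    refine ⟨c / (K + K' + 1), by positivity, fun x => ?_⟩
    rw [div_mul_eq_mul_div, div_le_iff₀ (by positivity), hg]
    calc c * ‖x‖ ^ 2 ≤ c * (K * ‖A x‖ ^ 2 + K' * ‖ι x‖ ^ 2) := by gcongr; exact hell x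
      _ ≤ c * ((‖A x‖ ^ 2 + ‖ι x‖ ^ 2) * (K + K' + 1)) := by
        gcongr
        nlinarith [mul_nonneg hK (sq_nonneg ‖ι x‖), mul_nonneg hK' (sq_nonneg ‖A x‖),
          sq_nonneg ‖A x‖, sq_nonneg ‖ι x‖]
      _ = (c * ‖A x‖ ^ 2 + c * ‖ι x‖ ^ 2) * (K + K' + 1) := by ring
      _ ≤ _ := by
        gcongr
        · exact hc _
        · exact hc _
  obtain ⟨e, he⟩ := exists_equiv_dual_of_coercive hgc
  let β : StrongDual ℝ H₁ →L[ℝ] StrongDual ℝ H₁ →L[ℝ] ℝ :=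
    (ContinuousLinearMap.compL ℝ (StrongDual ℝ H₁) H₁ ℝ).flip e.symm
  have hβ : ∀ φ ψ, β φ ψ = φ (e.symm ψ) := fun φ ψ => rfl
  have hβsym : ∀ φ ψ, β φ ψ = β ψ φ := by
    intro φ ψ
    obtain ⟨u, rfl⟩ := e.surjective φ
    obtain ⟨v, rfl⟩ := e.surjective ψ
    rw [hβ, hβ, e.symm_apply_apply, e.symm_apply_apply, he, he, hgsym]
  refine ⟨β, hβsym, ?_, ?_⟩
  · obtain ⟨c, hc0, hc⟩ := hgc
    refine ⟨c / (‖g‖ + 1) ^ 2, by positivity, fun φ => ?_⟩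
    obtain ⟨u, rfl⟩ := e.surjective φ
    rw [hβ, e.symm_apply_apply, he, div_mul_eq_mul_div, div_le_iff₀ (by positivity)]
    have h1 : ‖g u‖ ≤ (‖g‖ + 1) * ‖u‖ := g.le_of_opNorm_le (by linarith) u
    calc c * ‖g u‖ ^ 2 ≤ c * ((‖g‖ + 1) * ‖u‖) ^ 2 := by gcongr
      _ = (c * ‖u‖ ^ 2) * (‖g‖ + 1) ^ 2 := by ring
      _ ≤ _ := by gcongr; exact hc u
  -- For `η = b p`, the equation `e x = ι* η` is the weak form of `A² x + x = p`. Self-adjointness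
  -- upgrades it to a strong one: `A x` lies in the image of `ι`, with preimage `u`.
  · have key : ∀ η : StrongDual ℝ H₀, ∃ p u x, η = b p ∧ A x = ι u ∧ p = A u + ι x ∧
        e.symm (banachAdjoint ι η) = x := by
      intro η
      obtain ⟨p, rfl⟩ := e₀.surjective η
      obtain ⟨x, hx⟩ := e.surjective (banachAdjoint ι (e₀ p))
      have hx' : ∀ y, b (A x) (A y) = b (p - ι x) (ι y) := by
        intro y
        have := DFunLike.congr_fun hx y
        rw [he, hg, banachAdjoint_apply_apply, he₀] at this
        rw [map_sub, sub_apply, ← this, add_sub_cancel_right]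
      obtain ⟨u, hu, hu'⟩ := h.exists_of_forall_form_eq hι hc hA hx'
      exact ⟨p, u, x, he₀ p, hu.symm, by rw [hu', sub_add_cancel],
        by rw [← hx, e.symm_apply_apply]⟩
    intro η θ
    rw [hβsym (banachAdjoint ι η), hβ, hβ]
    obtain ⟨p, u, x, rfl, hxu, hp, hx⟩ := key η
    obtain ⟨p', u', x', rfl, hxu', hp', hx'⟩ := key θ
    rw [hx, hx', neg_apply, neg_apply, banachAdjoint_apply_apply, banachAdjoint_apply_apply,
      hxu, hxu', hp, hp']
    have h1 : b (ι x) (ι u') = b (ι x') (ι u) := by rw [← hxu', ← hA, hxu, hsym]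
    rw [map_add, map_add, _root_.add_apply, _root_.add_apply, hA, h1, hsym (ι u)]

/-- The elliptic bound for the adjoint is dual to surjectivity of `(x, y) ↦ A x + ι y`: bounded
preimages bound `‖η‖` by a multiple of `‖A* η‖ + ‖ι* η‖`. -/
theorem IsHessian.exists_modelEstimate_dual {H₀ H₁ : Type*} [NormedAddCommGroup H₀]
    [InnerProductSpace ℝ H₀] [CompleteSpace H₀] [NormedAddCommGroup H₁] [InnerProductSpace ℝ H₁]
    [CompleteSpace H₁] {ι A : H₁ →L[ℝ] H₀} (h : IsHessian ι A) (hι : Function.Injective ι) :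
    ∃ C ≥ 0, ∃ C' ≥ 0, ModelEstimate (banachAdjoint ι) (-banachAdjoint A) C C' := by
  obtain ⟨β, hsym, ⟨c, hc0, hc⟩, hA⟩ := h.exists_form_dual hι
  have hsurj : Function.Surjective (A.coprod ι) := fun v => by
    obtain ⟨x, k, -, hv⟩ := h.exists_eq_add hι v
    exact ⟨(x, k), by simp [hv]⟩
  obtain ⟨K, hK, hpre⟩ := (A.coprod ι).exists_preimage_norm_le hsurj
  refine ⟨_, ?_, 2 * K ^ 2, by positivity, modelEstimate_of_symm hsym hc0 hc hA
    (K := 2 * K ^ 2) (by positivity) fun η => exists_sq_le_of_le_add (norm_nonneg _) ?_⟩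
  · positivity
  rw [neg_apply, norm_neg]
  refine η.opNorm_le_bound (by positivity) fun v => ?_
  obtain ⟨⟨x, y⟩, rfl, hxy⟩ := hpre v
  have hx : ‖x‖ ≤ K * ‖A.coprod ι (x, y)‖ := (norm_fst_le (x, y)).trans hxy
  have hy : ‖y‖ ≤ K * ‖A.coprod ι (x, y)‖ := (norm_snd_le (x, y)).trans hxy
  calc ‖η (A.coprod ι (x, y))‖ = ‖banachAdjoint A η x + banachAdjoint ι η y‖ := by
        simp [banachAdjoint_apply_apply]
    _ ≤ ‖banachAdjoint A η‖ * (K * ‖A.coprod ι (x, y)‖)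
        + ‖banachAdjoint ι η‖ * (K * ‖A.coprod ι (x, y)‖) :=
      (norm_add_le _ _).trans (add_le_add ((banachAdjoint A η).le_opNorm_of_le hx)
        ((banachAdjoint ι η).le_opNorm_of_le hy))
    _ = _ := by ring

theorem IsHessian.exists_modelEstimate_dual_of_isInvertible {H₀ H₁ : Type*} [NormedAddCommGroup H₀]
    [InnerProductSpace ℝ H₀] [CompleteSpace H₀] [NormedAddCommGroup H₁] [InnerProductSpace ℝ H₁]
    [CompleteSpace H₁] {ι A : H₁ →L[ℝ] H₀} (h : IsHessian ι A) (hι : Function.Injective ι)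
    (hinv : A.IsInvertible) :
    ∃ C ≥ 0, ModelEstimate (banachAdjoint ι) (-banachAdjoint A) C 0 := by
  obtain ⟨β, hsym, ⟨c, hc0, hc⟩, hA⟩ := h.exists_form_dual hι
  obtain ⟨e, rfl⟩ := hinv
  refine ⟨_, ?_, modelEstimate_of_symm hsym hc0 hc hA (sq_nonneg ‖(e.symm : H₀ →L[ℝ] H₁)‖)
    (K' := 0) fun η => ?_⟩
  · positivity
  · rw [zero_mul, add_zero, ← mul_pow, neg_apply, norm_neg]
    refine pow_le_pow_left₀ (norm_nonneg _) (η.opNorm_le_bound (by positivity) fun v => ?_) 2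
    have h1 : η v = banachAdjoint (e : H₁ →L[ℝ] H₀) η ((e.symm : H₀ →L[ℝ] H₁) v) := by
      simp [banachAdjoint_apply_apply]
    rw [h1, mul_comm ‖_‖ ‖_‖, mul_assoc]
    exact (banachAdjoint (e : H₁ →L[ℝ] H₀) η).le_opNorm_of_le
      ((e.symm : H₀ →L[ℝ] H₁).le_opNorm v)

/-! ### The a priori estimates -/

theorem IsHessianPath.exists_estimate {H₀ H₁ : Type*}
    [NormedAddCommGroup H₀] [InnerProductSpace ℝ H₀] [CompleteSpace H₀]
    [NormedAddCommGroup H₁] [InnerProductSpace ℝ H₁] [CompleteSpace H₁]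
    {ι : H₁ →L[ℝ] H₀} (hι : Function.Injective ι)
    {A : ℝ → (H₁ →L[ℝ] H₀)} (hA : IsHessianPath ι A) :
    ∃ c > 0, ∃ T > 0, ∀ ξ : PathW ι,
      ‖ξ‖ ≤ c * (normOnIcc T ξ + ‖pathOp ι hA.toBCF ξ‖) := by
  refine exists_global_estimate (fun t => (hA.hessian t).exists_modelEstimate hι) ?_ ?_
  · obtain ⟨A', h1, h2, h3⟩ := hA.limit_top
    exact ⟨A', h1.exists_modelEstimate_of_isInvertible h2, h3⟩
  · obtain ⟨A', h1, h2, h3⟩ := hA.limit_bot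
    exact ⟨A', h1.exists_modelEstimate_of_isInvertible h2, h3⟩

theorem IsHessianPath.exists_estimate_dual {H₀ H₁ : Type*}
    [NormedAddCommGroup H₀] [InnerProductSpace ℝ H₀] [CompleteSpace H₀]
    [NormedAddCommGroup H₁] [InnerProductSpace ℝ H₁] [CompleteSpace H₁]
    {ι : H₁ →L[ℝ] H₀} (hι : Function.Injective ι)
    {A : ℝ → (H₁ →L[ℝ] H₀)} (hA : IsHessianPath ι A) :
    ∃ c > 0, ∃ T > 0, ∀ η : PathW (banachAdjoint ι),
      ‖η‖ ≤ c * (normOnIcc T η + ‖pathOp (banachAdjoint ι) (negAdjointPath hA.toBCF) η‖) := by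
  refine exists_global_estimate (fun t => (hA.hessian t).exists_modelEstimate_dual hι) ?_ ?_
  · obtain ⟨A', h1, h2, h3⟩ := hA.limit_top
    exact ⟨_, h1.exists_modelEstimate_dual_of_isInvertible hι h2,
      ((banachAdjoint.continuous.tendsto A').comp h3).neg⟩
  · obtain ⟨A', h1, h2, h3⟩ := hA.limit_bot
    exact ⟨_, h1.exists_modelEstimate_dual_of_isInvertible hι h2,
      ((banachAdjoint.continuous.tendsto A').comp h3).neg⟩

/-! ### Operators which are small on subspaces of finite codimension -/

/-- On suitable closed subspaces of finite codimension `p` is bounded by an arbitrarily small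
multiple of the norm. For `p = ‖T ·‖` with `T` bounded this means that `T` is compact. -/
def IsSmallModFinite {X : Type*} [NormedAddCommGroup X] [NormedSpace ℝ X] (p : X → ℝ) : Prop :=
  ∀ ε > 0, ∃ K : Submodule ℝ X, IsClosed (K : Set X) ∧ K.CoFG ∧ ∀ x ∈ K, p x ≤ ε * ‖x‖

theorem IsCompactOperator.exists_finite_net {X Y : Type*} [NormedAddCommGroup X] [NormedSpace ℝ X]
    [NormedAddCommGroup Y] [NormedSpace ℝ Y] {T : X →L[ℝ] Y} (hT : IsCompactOperator T) {ε : ℝ}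
    (hε : 0 < ε) : ∃ t : Finset Y, ∀ x, ‖x‖ = 1 → ∃ y ∈ t, ‖T x - y‖ ≤ ε := by
  obtain ⟨S, hS, hTS⟩ := IsCompactOperator.image_closedBall_subset_compact (f := T.toLinearMap) hT 1
  obtain ⟨t, -, hfin, ht⟩ := hS.finite_cover_balls hε
  refine ⟨hfin.toFinset, fun x hx => ?_⟩
  have hxS : T x ∈ S := hTS ⟨x, by simp [hx], rfl⟩
  obtain ⟨y, hy, hxy⟩ := Set.mem_iUnion₂.1 (ht hxS)
  exact ⟨y, hfin.mem_toFinset.2 hy, by rw [← dist_eq_norm]; exact (Metric.mem_ball.1 hxy).le⟩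

theorem ContinuousLinearMap.isClosed_ker_cofg {X V : Type*} [NormedAddCommGroup X] [NormedSpace ℝ X]
    [NormedAddCommGroup V] [NormedSpace ℝ V] [FiniteDimensional ℝ V] (Φ : X →L[ℝ] V) :
    IsClosed (Φ.ker : Set X) ∧ Φ.ker.CoFG :=
  ⟨Φ.isClosed_ker, Submodule.CoFG.ker _⟩

/-- Take the vectors whose image is orthogonal to a finite `ε`-net `t` of the image of the unit
sphere. If `T z` is `ε`-close to `y` and orthogonal to it, then `‖T z‖² = ⟪T z - y, T z⟫ ≤ ε ‖T z‖`.
-/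
theorem IsCompactOperator.isSmallModFinite {X H : Type*} [NormedAddCommGroup X] [NormedSpace ℝ X]
    [NormedAddCommGroup H] [InnerProductSpace ℝ H] {T : X →L[ℝ] H} (hT : IsCompactOperator T) :
    IsSmallModFinite fun x => ‖T x‖ := by
  intro ε hε
  obtain ⟨t, ht⟩ := hT.exists_finite_net hε
  let Φ : X →L[ℝ] (t → ℝ) := ContinuousLinearMap.pi fun y => innerSL ℝ (y : H) ∘L T
  obtain ⟨h1, h2⟩ := Φ.isClosed_ker_cofg
  refine ⟨Φ.ker, h1, h2, fun x hx => ?_⟩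
  have key : ‖T ∘L Φ.ker.subtypeL‖ ≤ ε := by
    refine ContinuousLinearMap.opNorm_le_of_unit_norm hε.le fun z hz => ?_
    obtain ⟨y, hy, hzy⟩ := ht z (by simpa using hz)
    have h0 : inner ℝ y (T z) = 0 := congrFun (show Φ z = 0 from z.2) ⟨y, hy⟩
    have h3 : ‖T z‖ * ‖T z‖ ≤ ε * ‖T z‖ := by
      rw [← real_inner_self_eq_norm_mul_norm]
      calc inner ℝ (T z) (T z) = inner ℝ (T (z : X) - y) (T z) := by rw [inner_sub_left, h0, sub_zero]
        _ ≤ ‖T z - y‖ * ‖T z‖ := real_inner_le_norm _ _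
        _ ≤ _ := by gcongr
    change ‖T z‖ ≤ ε
    rcases (norm_nonneg (T (z : X))).eq_or_lt with h4 | h4
    · rw [← h4]; exact hε.le
    · exact le_of_mul_le_mul_right h3 h4
  exact (T ∘L Φ.ker.subtypeL).le_of_opNorm_le key ⟨x, hx⟩

/-- This is Schauder's theorem in quantitative form: a functional vanishing on the net satisfies `η
(T x) = η (T x - y)`. -/
theorem IsCompactOperator.isSmallModFinite_banachAdjoint {E₀ E₁ : Type*} [NormedAddCommGroup E₀]
    [NormedSpace ℝ E₀] [NormedAddCommGroup E₁] [NormedSpace ℝ E₁] {T : E₁ →L[ℝ] E₀}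
    (hT : IsCompactOperator T) : IsSmallModFinite fun η => ‖banachAdjoint T η‖ := by
  intro ε hε
  obtain ⟨t, ht⟩ := hT.exists_finite_net hε
  let Φ : StrongDual ℝ E₀ →L[ℝ] (t → ℝ) :=
    ContinuousLinearMap.pi fun y => ContinuousLinearMap.apply ℝ ℝ (y : E₀)
  obtain ⟨h1, h2⟩ := Φ.isClosed_ker_cofg
  refine ⟨Φ.ker, h1, h2, fun η hη => ?_⟩
  refine ContinuousLinearMap.opNorm_le_of_unit_norm (by positivity) fun x hx => ?_
  obtain ⟨y, hy, hxy⟩ := ht x hx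
  have h0 : η y = 0 := congrFun (show Φ η = 0 from hη) ⟨y, hy⟩
  rw [banachAdjoint_apply_apply, ← sub_zero (η (T x)), ← h0, ← map_sub, mul_comm]
  exact η.le_opNorm_of_le hxy

/-! ### Local compactness of the inclusion of the path space -/

theorem lintegral_sq_le {α : Type*} [MeasurableSpace α] {μ : Measure α} {w : α → ENNReal}
    (hw : AEMeasurable w μ) : (∫⁻ t, w t ∂μ) ^ 2 ≤ μ Set.univ * ∫⁻ t, w t ^ 2 ∂μ := by
  have h := ENNReal.lintegral_mul_le_Lp_mul_Lq μ Real.HolderConjugate.two_two hw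
    (aemeasurable_const (b := (1 : ENNReal)))
  simp only [Pi.mul_apply, mul_one, ENNReal.one_rpow, lintegral_const, one_mul] at h
  refine (pow_le_pow_left' h 2).trans_eq ?_
  rw [mul_pow, mul_comm, ← ENNReal.rpow_mul_natCast, ← ENNReal.rpow_mul_natCast]
  norm_num

theorem ENNReal.add_sq_le (a b : ENNReal) :
    (a + b) ^ 2 ≤ ENNReal.ofReal 2 * (a ^ 2 + b ^ 2) := by
  have h := ENNReal.rpow_add_le_mul_rpow_add_rpow a b (one_le_two (α := ℝ))
  norm_num at h
  simpa using h

theorem HasWeakDeriv.lintegral_translate_le {E : Type*} [NormedAddCommGroup E] [NormedSpace ℝ E]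
    [CompleteSpace E] {f g : PathL2 E} (h : HasWeakDeriv f g) (u : ℝ) :
    ∫⁻ s, ‖f s - f (s + u)‖ₑ ^ 2 ≤ ENNReal.ofReal (u ^ 2 * ‖g‖ ^ 2) := by
  have h1 := h.norm_pathTranslate_sub_le u
  have h2 : ∫⁻ s, ‖f s - f (s + u)‖ₑ ^ 2 = ENNReal.ofReal (‖pathTranslate u f - f‖ ^ 2) := by
    rw [PathL2.norm_sq_eq, ofReal_integral_eq_lintegral_ofReal (PathL2.integrable_norm_sq _)
      (.of_forall fun s => by positivity)]
    refine lintegral_congr_ae ?_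
    filter_upwards [coeFn_pathTranslate u f, Lp.coeFn_sub (pathTranslate u f) f] with s e1 e2
    rw [e2, Pi.sub_apply, e1, norm_sub_rev, ENNReal.ofReal_pow (norm_nonneg _), ofReal_norm,
      add_comm u]
  rw [h2, ← sq_abs u, ← mul_pow]
  gcongr

/-- Substitute `t = s + u` with `|u| ≤ b - a`, enlarge the `s`-integral to the line, and exchange
the integrals; the translation bound then applies for each `u`, and `2 * (b - a)` is the length of
the range of `u`. -/
theorem HasWeakDeriv.lintegral_lintegral_le {E : Type*} [NormedAddCommGroup E] [NormedSpace ℝ E]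
    [CompleteSpace E] {f g : PathL2 E} (h : HasWeakDeriv f g) (a b : ℝ) :
    ∫⁻ s in Set.Icc a b, ∫⁻ t in Set.Icc a b, ‖f s - f t‖ₑ ^ 2 ≤
      ENNReal.ofReal ((b - a) ^ 2 * ‖g‖ ^ 2 * (2 * (b - a))) := by
  have hf : StronglyMeasurable f := Lp.stronglyMeasurable f
  have hmeas : Measurable fun p : ℝ × ℝ => ‖f p.1 - f (p.1 + p.2)‖ₑ ^ 2 :=
    ((hf.comp_measurable measurable_fst).sub
      (hf.comp_measurable (measurable_fst.add measurable_snd))).enorm.pow_const 2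
  calc ∫⁻ s in Set.Icc a b, ∫⁻ t in Set.Icc a b, ‖f s - f t‖ₑ ^ 2
      ≤ ∫⁻ s in Set.Icc a b, ∫⁻ u in Set.Icc (-(b - a)) (b - a), ‖f s - f (s + u)‖ₑ ^ 2 := by
        refine setLIntegral_mono' measurableSet_Icc fun s hs => ?_
        rw [← lintegral_indicator measurableSet_Icc, ← lintegral_indicator measurableSet_Icc,
          ← lintegral_add_left_eq_self _ s]
        refine lintegral_mono fun u => ?_
        by_cases hu : s + u ∈ Set.Icc a b
        · have hu' : u ∈ Set.Icc (-(b - a)) (b - a) :=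
            ⟨by linarith [hs.2, hu.1], by linarith [hs.1, hu.2]⟩
          rw [Set.indicator_of_mem hu, Set.indicator_of_mem hu']
        · simp [Set.indicator_of_notMem hu]
    _ ≤ ∫⁻ s, ∫⁻ u in Set.Icc (-(b - a)) (b - a), ‖f s - f (s + u)‖ₑ ^ 2 :=
        setLIntegral_le_lintegral _ _
    _ = ∫⁻ u in Set.Icc (-(b - a)) (b - a), ∫⁻ s, ‖f s - f (s + u)‖ₑ ^ 2 :=
        lintegral_lintegral_swap hmeas.aemeasurable
    _ ≤ ∫⁻ u in Set.Icc (-(b - a)) (b - a), ENNReal.ofReal ((b - a) ^ 2 * ‖g‖ ^ 2) := by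
        refine setLIntegral_mono' measurableSet_Icc fun u hu =>
          (h.lintegral_translate_le u).trans (ENNReal.ofReal_le_ofReal ?_)
        gcongr ?_ * _
        exact sq_le_sq' hu.1 hu.2
    _ = _ := by
        rw [setLIntegral_const, Real.volume_Icc, ← ENNReal.ofReal_mul (by positivity)]
        congr 2
        ring

/-- The Poincaré inequality on an interval. -/
theorem HasWeakDeriv.setIntegral_norm_sq_le {E : Type*} [NormedAddCommGroup E] [NormedSpace ℝ E]
    [CompleteSpace E] {f g : PathL2 E} (h : HasWeakDeriv f g) {a b : ℝ} (hab : a < b) :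
    ∫ s in Set.Icc a b, ‖f s‖ ^ 2 ≤
      4 * (b - a) ^ 2 * ‖g‖ ^ 2 + 2 / (b - a) * ‖∫ s in Set.Icc a b, f s‖ ^ 2 := by
  have hf : StronglyMeasurable f := Lp.stronglyMeasurable f
  set l := b - a with hl
  have hl0 : 0 < l := sub_pos.2 hab
  set m := ∫ s in Set.Icc a b, f s with hm
  have hvol : (volume.restrict (Set.Icc a b)) Set.univ = ENNReal.ofReal l := by simp [hl]
  have hint : IntegrableOn f (Set.Icc a b) :=
    ((Lp.memLp f).locallyIntegrable one_le_two).integrableOn_isCompact isCompact_Icc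
  -- Pointwise, `l • f s` is the integral of `f s - f t` over `t` plus the total integral `m`;
  -- Cauchy–Schwarz squares the first part.
  have hpt : ∀ s, ENNReal.ofReal l ^ 2 * ‖f s‖ₑ ^ 2 ≤
      ENNReal.ofReal 2 * (ENNReal.ofReal l * ∫⁻ t in Set.Icc a b, ‖f s - f t‖ₑ ^ 2) + ENNReal.ofReal 2 * ‖m‖ₑ ^ 2 := by
    intro s
    have e1 : l • f s = (∫ t in Set.Icc a b, (f s - f t)) + m := by
      rw [integral_sub (integrable_const _) hint, sub_add_cancel, setIntegral_const]
      simp [Measure.real, hl, hab.le]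
    have e2 : ENNReal.ofReal l * ‖f s‖ₑ ≤ (∫⁻ t in Set.Icc a b, ‖f s - f t‖ₑ) + ‖m‖ₑ := by
      rw [← Real.enorm_of_nonneg hl0.le, ← enorm_smul, e1]
      exact (enorm_add_le _ _).trans (by gcongr; exact enorm_integral_le_lintegral_enorm _)
    rw [← mul_pow]
    refine (pow_le_pow_left' e2 2).trans ?_
    refine (ENNReal.add_sq_le _ _).trans ?_
    rw [mul_add, ← hvol]
    gcongr
    exact lintegral_sq_le (stronglyMeasurable_const.sub hf).enorm.aemeasurable
  have hmeas : Measurable fun s => ∫⁻ t in Set.Icc a b, ‖f s - f t‖ₑ ^ 2 :=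
    Measurable.lintegral_prod_right' (f := fun p : ℝ × ℝ => ‖f p.1 - f p.2‖ₑ ^ 2)
      (((hf.comp_measurable measurable_fst).sub
      (hf.comp_measurable measurable_snd)).enorm.pow_const 2)
  have htot : ENNReal.ofReal l ^ 2 * ∫⁻ s in Set.Icc a b, ‖f s‖ₑ ^ 2 ≤
      ENNReal.ofReal 2 * (ENNReal.ofReal l * ENNReal.ofReal (l ^ 2 * ‖g‖ ^ 2 * (2 * l)))
        + ENNReal.ofReal 2 * ‖m‖ₑ ^ 2 * ENNReal.ofReal l := by
    rw [← lintegral_const_mul _ (hf.enorm.pow_const 2)]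
    refine (lintegral_mono hpt).trans ?_
    rw [lintegral_add_right _ measurable_const, lintegral_const_mul _ (hmeas.const_mul _),
      lintegral_const_mul _ hmeas, lintegral_const, hvol]
    gcongr
    exact h.lintegral_lintegral_le a b
  have e1 : ∫⁻ s in Set.Icc a b, ‖f s‖ₑ ^ 2 = ENNReal.ofReal (∫ s in Set.Icc a b, ‖f s‖ ^ 2) := by
    rw [ofReal_integral_eq_lintegral_ofReal (PathL2.integrable_norm_sq f).restrict
      (.of_forall fun s => by positivity)]
    refine lintegral_congr fun s => ?_
    rw [ENNReal.ofReal_pow (norm_nonneg _), ofReal_norm]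
  rw [e1, ← ofReal_norm, ← ENNReal.ofReal_pow hl0.le, ← ENNReal.ofReal_pow (norm_nonneg _),
    ← ENNReal.ofReal_mul (by positivity), ← ENNReal.ofReal_mul (by positivity),
    ← ENNReal.ofReal_mul (by positivity), ← ENNReal.ofReal_mul (by positivity),
    ← ENNReal.ofReal_mul (by positivity), ← ENNReal.ofReal_add (by positivity) (by positivity),
    ENNReal.ofReal_le_ofReal_iff (by positivity)] at htot
  refine le_of_mul_le_mul_left (htot.trans_eq ?_) (by positivity : 0 < l ^ 2)
  field_simp
  ring

section PathW

variable {E₀ E₁ : Type*} [NormedAddCommGroup E₀] [NormedSpace ℝ E₀] [CompleteSpace E₀]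
    [NormedAddCommGroup E₁] [NormedSpace ℝ E₁] [CompleteSpace E₁] {ι : E₁ →L[ℝ] E₀}

theorem Submodule.CoFG.comap_linearMap {X Y : Type*} [AddCommGroup X] [Module ℝ X] [AddCommGroup Y]
    [Module ℝ Y] {K : Submodule ℝ Y} (hK : K.CoFG) (m : X →ₗ[ℝ] Y) : (K.comap m).CoFG := by
  have h : K.comap m = (K.mkQ ∘ₗ m).ker := by rw [LinearMap.ker_comp, Submodule.ker_mkQ]
  have := hK
  rw [h]
  exact Submodule.CoFG.ker _

/-- After Poincaré only the integral of `ξ` over the interval remains, and it is taken in `E₁`.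
Requiring it to lie in a subspace where `ι` is small is a closed condition of finite codimension on
`ξ`. -/
theorem IsSmallModFinite.exists_setIntegral_le (hι : IsSmallModFinite fun x => ‖ι x‖) {a b : ℝ}
    (hab : a < b) {δ : ℝ} (hδ : 0 < δ) :
    ∃ K : Submodule ℝ (PathW ι), IsClosed (K : Set (PathW ι)) ∧ K.CoFG ∧ ∀ ξ ∈ K,
      ∫ s in Set.Icc a b, ‖ι (ξ.1.fst s)‖ ^ 2 ≤ (4 * (b - a) ^ 2 + δ) * ‖ξ‖ ^ 2 := by
  have hab' : 0 < b - a := sub_pos.2 hab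
  have hφ : MemLp ((Set.Icc a b).indicator fun _ => (1 : ℝ)) 2 (volume : Measure ℝ) :=
    memLp_indicator_const 2 measurableSet_Icc 1 (.inr (by simp))
  let m : PathW ι →L[ℝ] E₁ :=
    testL hφ ∘L WithLp.fstL 2 ℝ (PathL2 E₁) (PathL2 E₀) ∘L (PathW ι).subtypeL
  have hm : ∀ ξ : PathW ι, m ξ = ∫ s in Set.Icc a b, ξ.1.fst s := by
    intro ξ
    rw [← integral_indicator measurableSet_Icc]
    refine (testL_apply hφ ξ.1.fst).trans (integral_congr_ae (.of_forall fun s => ?_))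
    by_cases hs : s ∈ Set.Icc a b
    · simp [Set.indicator_of_mem hs]
    · simp [Set.indicator_of_notMem hs]
  -- This threshold makes the mean term of the Poincaré inequality at most `δ * ‖ξ‖ ^ 2`.
  obtain ⟨K, hK, hKf, hKs⟩ := hι √(δ / (2 / (b - a) * (‖m‖ ^ 2 + 1))) (by positivity)
  refine ⟨K.comap m.toLinearMap, hK.preimage m.continuous, hKf.comap_linearMap _, fun ξ hξ => ?_⟩
  set f := pathConst ι ξ.1.fst with hf
  have hint : IntegrableOn ξ.1.fst (Set.Icc a b) :=
    ((Lp.memLp ξ.1.fst).locallyIntegrable one_le_two).integrableOn_isCompact isCompact_Icc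
  have e1 : ∫ s in Set.Icc a b, ‖ι (ξ.1.fst s)‖ ^ 2 = ∫ s in Set.Icc a b, ‖f s‖ ^ 2 := by
    refine setIntegral_congr_ae measurableSet_Icc ?_
    filter_upwards [coeFn_pathConst ι ξ.1.fst] with s h _
    rw [hf, h]
  have e2 : ∫ s in Set.Icc a b, f s = ι (m ξ) := by
    rw [hm, ← ι.integral_comp_comm hint]
    refine setIntegral_congr_ae measurableSet_Icc ?_
    filter_upwards [coeFn_pathConst ι ξ.1.fst] with s h _
    rw [hf, h]
  have e3 := (PathW.hasWeakDeriv ξ).setIntegral_norm_sq_le hab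
  have e4 : ‖ι (m ξ)‖ ^ 2 ≤ δ / (2 / (b - a) * (‖m‖ ^ 2 + 1)) * (‖m‖ ^ 2 * ‖ξ‖ ^ 2) := by
    refine (pow_le_pow_left₀ (norm_nonneg _) (hKs (m ξ) hξ) 2).trans ?_
    rw [mul_pow, Real.sq_sqrt (by positivity), ← mul_pow]
    gcongr
    exact m.le_opNorm ξ
  have e5 : 2 / (b - a) * ‖ι (m ξ)‖ ^ 2 ≤ δ * ‖ξ‖ ^ 2 := by
    calc 2 / (b - a) * ‖ι (m ξ)‖ ^ 2
        ≤ 2 / (b - a) * (δ / (2 / (b - a) * (‖m‖ ^ 2 + 1)) * (‖m‖ ^ 2 * ‖ξ‖ ^ 2)) := by gcongr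
      _ = δ * ‖ξ‖ ^ 2 * (‖m‖ ^ 2 / (‖m‖ ^ 2 + 1)) := by field_simp
      _ ≤ δ * ‖ξ‖ ^ 2 * 1 := by
        gcongr
        rw [div_le_one (by positivity)]
        linarith
      _ = _ := mul_one _
  have e6 : ‖ξ.1.snd‖ ^ 2 ≤ ‖ξ‖ ^ 2 := by
    rw [PathW.norm_sq_eq]
    linarith [sq_nonneg ‖ξ.1.fst‖]
  rw [e1]
  rw [e2] at e3
  nlinarith [mul_le_mul_of_nonneg_left e6 (by positivity : 0 ≤ 4 * (b - a) ^ 2)]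

/-- Each of the `n` adjacent intervals is charged the norm on the whole line. This is affordable
because the Poincaré constant is quadratic in `l`, so `n * l ^ 2` tends to zero when `n * l` is
fixed. -/
theorem IsSmallModFinite.exists_setIntegral_le_nat (hι : IsSmallModFinite fun x => ‖ι x‖) (a : ℝ)
    {l δ : ℝ} (hl : 0 < l) (hδ : 0 < δ) (n : ℕ) :
    ∃ K : Submodule ℝ (PathW ι), IsClosed (K : Set (PathW ι)) ∧ K.CoFG ∧ ∀ ξ ∈ K,
      ∫ s in Set.Icc a (a + n * l), ‖ι (ξ.1.fst s)‖ ^ 2 ≤ n * (4 * l ^ 2 + δ) * ‖ξ‖ ^ 2 := by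
  induction n with
  | zero => exact ⟨⊤, isClosed_univ, .top, fun ξ _ => by simp⟩
  | succ n ih =>
    obtain ⟨K, hK, hKf, hKs⟩ := ih
    obtain ⟨K', hK', hKf', hKs'⟩ := hι.exists_setIntegral_le
      (by linarith : a + n * l < a + n * l + l) hδ
    refine ⟨K ⊓ K', hK.inter hK', hKf.inf hKf', fun ξ hξ => ?_⟩
    have h1 := hKs ξ hξ.1
    have h2 := hKs' ξ hξ.2
    rw [add_sub_cancel_left] at h2
    have hsub : Set.Icc a (a + (n + 1 : ℕ) * l) ⊆
        Set.Icc a (a + n * l) ∪ Set.Icc (a + n * l) (a + n * l + l) := by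
      intro s hs
      push_cast at hs
      rcases le_total s (a + n * l) with h | h
      · exact .inl ⟨hs.1, h⟩
      · exact .inr ⟨h, by linarith [hs.2]⟩
    have hi := PathW.integrable_norm_sq ξ
    have h3 : ∫ s in Set.Icc a (a + (n + 1 : ℕ) * l), ‖ι (ξ.1.fst s)‖ ^ 2 ≤
        (∫ s in Set.Icc a (a + n * l), ‖ι (ξ.1.fst s)‖ ^ 2)
          + ∫ s in Set.Icc (a + n * l) (a + n * l + l), ‖ι (ξ.1.fst s)‖ ^ 2 := by
      rw [← integral_add_measure hi.restrict hi.restrict]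
      exact integral_mono_measure ((Measure.restrict_mono_set _ hsub).trans
        (Measure.restrict_union_le _ _)) (.of_forall fun s => by positivity)
        (hi.restrict.add_measure hi.restrict)
    push_cast at h3 ⊢
    linarith

/-- If the inclusion `E₁ → E₀` is compact, then so is the restriction `P₁(ℝ; E₁, E₀) →
P₀([-T, T]; E₀)`. -/
theorem IsSmallModFinite.normOnIcc (hι : IsSmallModFinite fun x => ‖ι x‖) {T : ℝ} (hT : 0 < T) :
    IsSmallModFinite fun ξ : PathW ι => normOnIcc T ξ := by
  intro ε hε
  -- With `l = 2 * T / n` and `δ = ε ^ 2 / (2 * n)`, the Poincaré terms sum to `16 * T ^ 2 / n` and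
  -- the mean terms to `ε ^ 2 / 2`; this `n` makes the former at most `ε ^ 2 / 2` too.
  obtain ⟨n, hn⟩ := exists_nat_gt (32 * T ^ 2 / ε ^ 2)
  have hn0 : (0 : ℝ) < n := lt_of_le_of_lt (by positivity) hn
  obtain ⟨K, hK, hKf, hKs⟩ := hι.exists_setIntegral_le_nat (-T)
    (by positivity : 0 < 2 * T / n) (by positivity : 0 < ε ^ 2 / (2 * n)) n
  refine ⟨K, hK, hKf, fun ξ hξ => le_of_sq_le_sq ?_ (by positivity)⟩
  have h := hKs ξ hξ
  rw [show -T + n * (2 * T / n) = T by field_simp; ring] at h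
  rw [normOnIcc_sq, mul_pow]
  refine h.trans (mul_le_mul_of_nonneg_right ?_ (sq_nonneg _))
  rw [div_lt_iff₀ (by positivity)] at hn
  have e : n * (4 * (2 * T / n) ^ 2 + ε ^ 2 / (2 * n)) = 16 * T ^ 2 / n + ε ^ 2 / 2 := by
    field_simp
    ring
  have e' : 16 * T ^ 2 / n ≤ ε ^ 2 / 2 := by
    rw [div_le_iff₀ hn0]
    linarith
  linarith

end PathW

theorem isClosed_pathW {E₀ E₁ : Type*} [NormedAddCommGroup E₀] [NormedSpace ℝ E₀] [CompleteSpace E₀]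
    [NormedAddCommGroup E₁] [NormedSpace ℝ E₁] {ι : E₁ →L[ℝ] E₀} :
    IsClosed (PathW ι : Set (WithLp 2 (PathL2 E₁ × PathL2 E₀))) := by
  have h : (PathW ι : Set (WithLp 2 (PathL2 E₁ × PathL2 E₀))) =
      ⋂ (φ : ℝ → ℝ) (_ : ContDiff ℝ ∞ φ) (_ : HasCompactSupport φ),
        {p | ∫ s, deriv φ s • ι (p.fst s) = -∫ s, φ s • p.snd s} := by
    ext p
    simp only [Set.mem_iInter]
    exact Iff.rfl
  rw [h]
  refine isClosed_iInter fun φ => isClosed_iInter fun hφ => isClosed_iInter fun hc => ?_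
  have m1 := memLp_of_test (hφ.continuous_deriv (by simp)) hc.deriv
  have m2 := memLp_of_test hφ.continuous hc
  have e1 : ∀ p : WithLp 2 (PathL2 E₁ × PathL2 E₀), ∫ s, deriv φ s • ι (p.fst s)
      = testL m1 (pathConst ι (WithLp.fstL 2 ℝ (PathL2 E₁) (PathL2 E₀) p)) := by
    intro p
    rw [testL_apply]
    refine integral_congr_ae ?_
    filter_upwards [coeFn_pathConst ι p.fst] with s h
    rw [WithLp.fstL_apply, h]
  have e2 : ∀ p : WithLp 2 (PathL2 E₁ × PathL2 E₀), ∫ s, φ s • p.snd s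
      = testL m2 (WithLp.sndL 2 ℝ (PathL2 E₁) (PathL2 E₀) p) := fun p => (testL_apply _ _).symm
  simp only [e1, e2]
  exact isClosed_eq (by fun_prop) (by fun_prop)

instance {E₀ E₁ : Type*} [NormedAddCommGroup E₀] [NormedSpace ℝ E₀] [CompleteSpace E₀]
    [NormedAddCommGroup E₁] [NormedSpace ℝ E₁] [CompleteSpace E₁] {ι : E₁ →L[ℝ] E₀} :
    CompleteSpace (PathW ι) := (isClosed_pathW (ι := ι)).completeSpace_coe

/-! ### Semi-Fredholm operators -/

/-- On a closed subspace `K` of finite codimension the term `p` is absorbed, so `D` is bounded below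
there and restricts to a closed embedding. Strictness and closed range pass from `K` to the whole
space, and the kernel meets `K` trivially, hence is finite dimensional. -/
theorem IsSmallModFinite.semiFredholm {X Y : Type*} [NormedAddCommGroup X] [NormedSpace ℝ X]
    [CompleteSpace X] [NormedAddCommGroup Y] [NormedSpace ℝ Y] {D : X →L[ℝ] Y} {p : X → ℝ}
    (hp : IsSmallModFinite p) {c : ℝ} (hc : 0 < c) (h : ∀ x, ‖x‖ ≤ c * (p x + ‖D x‖)) :
    IsStrictMap D ∧ IsClosed (D.range : Set Y) ∧ FiniteDimensional ℝ D.ker := by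
  obtain ⟨K, hK, hKf, hKs⟩ := hp (1 / (2 * c)) (by positivity)
  have hlow : ∀ x ∈ K, ‖x‖ ≤ 2 * c * ‖D x‖ := by
    intro x hx
    have h1 := h x
    have h2 := mul_le_mul_of_nonneg_left (hKs x hx) hc.le
    have h3 : c * (1 / (2 * c) * ‖x‖) = ‖x‖ / 2 := by field_simp
    linarith
  have : CompleteSpace K := hK.completeSpace_coe
  have hanti : AntilipschitzWith (2 * c).toNNReal (D.domRestrict K) := by
    refine (D.domRestrict K).antilipschitz_of_bound fun x => ?_
    rw [Real.coe_toNNReal _ (by positivity)]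
    exact hlow x x.2
  have huc := (D.domRestrict K).uniformContinuous
  have hr := (D.isStrictMap_isClosed_range_iff_restrict K hK).2
    ⟨(hanti.isUniformEmbedding huc).isEmbedding.isStrictMap, by
      rw [LinearMap.coe_range]; exact hanti.isClosed_range huc⟩
  have hdisj : Disjoint K D.ker := by
    rw [Submodule.disjoint_def]
    intro x hx hx'
    have h1 := hlow x hx
    rw [show D x = 0 from hx', norm_zero, mul_zero] at h1
    exact norm_le_zero_iff.1 h1
  exact ⟨hr.1, hr.2, Submodule.fg_iff_finiteDimensional _ |>.1 (hKf.fg_of_disjoint hdisj.symm)⟩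

/-! ### The cokernel -/

theorem hasWeakDeriv_smul_const {E : Type*} [NormedAddCommGroup E] [NormedSpace ℝ E]
    [CompleteSpace E] {φ : ℝ → ℝ} (hφ : ContDiff ℝ ∞ φ) (v : E) :
    HasWeakDeriv (fun s => φ s • v) (fun s => deriv φ s • v) := by
  intro ψ hψ hc
  have hφd : Continuous (deriv φ) := hφ.continuous_deriv (by simp)
  have hψd : Continuous (deriv ψ) := hψ.continuous_deriv (by simp)
  have i1 : Integrable (fun s => deriv ψ s * φ s) :=
    (hψd.mul hφ.continuous).integrable_of_hasCompactSupport hc.deriv.mul_right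
  have i2 : Integrable (fun s => ψ s * deriv φ s) :=
    (hψ.continuous.mul hφd).integrable_of_hasCompactSupport hc.mul_right
  have h0 := integral_eq_zero_of_hasDerivAt_of_integrable (f := fun s => ψ s * φ s)
    (f' := fun s => deriv ψ s * φ s + ψ s * deriv φ s)
    (fun s => (hψ.differentiable (by simp) s).hasDerivAt.fun_mul
      (hφ.differentiable (by simp) s).hasDerivAt) (i1.add i2)
    ((hψ.continuous.mul hφ.continuous).integrable_of_hasCompactSupport hc.mul_right)
  rw [integral_add i1 i2] at h0
  simp only [smul_smul]
  rw [integral_smul_const, integral_smul_const, ← neg_smul, eq_neg_of_add_eq_zero_left h0]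

theorem PathW.exists_smul_const {E₀ E₁ : Type*} [NormedAddCommGroup E₀] [NormedSpace ℝ E₀]
    [CompleteSpace E₀] [NormedAddCommGroup E₁] [NormedSpace ℝ E₁] (ι : E₁ →L[ℝ] E₀) {φ : ℝ → ℝ}
    (hφ : ContDiff ℝ ∞ φ) (hc : HasCompactSupport φ) (x : E₁) :
    ∃ ξ : PathW ι, (ξ.1.fst =ᵐ[volume] fun s => φ s • x) ∧
      (ξ.1.snd =ᵐ[volume] fun s => deriv φ s • ι x) := by
  have hφd : Continuous (deriv φ) := hφ.continuous_deriv (by simp)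
  have m1 : MemLp (fun s => φ s • x) 2 (volume : Measure ℝ) :=
    (hφ.continuous.smul continuous_const).memLp_of_hasCompactSupport hc.smul_right
  have m2 : MemLp (fun s => deriv φ s • ι x) 2 (volume : Measure ℝ) :=
    (hφd.smul continuous_const).memLp_of_hasCompactSupport hc.deriv.smul_right
  refine ⟨⟨WithLp.toLp 2 (m1.toLp _, m2.toLp _), ?_⟩, m1.coeFn_toLp, m2.coeFn_toLp⟩
  refine ((hasWeakDeriv_smul_const hφ (ι x)).congr_left ?_).congr_right m2.coeFn_toLp.symm
  filter_upwards [m1.coeFn_toLp] with s h1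
  rw [← map_smul]
  exact congrArg ι h1.symm

/-- The Riesz map of a real Hilbert space. -/
noncomputable def realRiesz (H : Type*) [NormedAddCommGroup H] [InnerProductSpace ℝ H] :
    H →L[ℝ] StrongDual ℝ H :=
  LinearMap.mkContinuous₂ (innerₗ H) 1 fun x y => by
    rw [one_mul]
    exact norm_inner_le_norm x y

theorem realRiesz_apply {H : Type*} [NormedAddCommGroup H] [InnerProductSpace ℝ H] (x y : H) :
    realRiesz H x y = inner ℝ x y := rfl

theorem pathConst_realRiesz_injective {H : Type*} [NormedAddCommGroup H] [InnerProductSpace ℝ H] :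
    Function.Injective (pathConst (realRiesz H)) := by
  rw [injective_iff_map_eq_zero]
  intro f hf
  refine Lp.ext ?_
  filter_upwards [coeFn_pathConst (realRiesz H) f, Lp.coeFn_zero (StrongDual ℝ H) 2 volume,
    Lp.coeFn_zero H 2 volume] with s h1 h2 h3
  rw [hf, h2] at h1
  rw [h3, Pi.zero_apply, ← inner_self_eq_zero (𝕜 := ℝ), ← realRiesz_apply, ← h1]
  rfl

theorem coeFn_pathMul_negAdjointPath {E₀ E₁ : Type*} [NormedAddCommGroup E₀] [NormedSpace ℝ E₀]
    [NormedAddCommGroup E₁] [NormedSpace ℝ E₁] (A : ℝ →ᵇ (E₁ →L[ℝ] E₀))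
    (f : PathL2 (StrongDual ℝ E₀)) :
    pathMul (negAdjointPath A) f =ᵐ[volume] fun s => -banachAdjoint (A s) (f s) :=
  coeFn_pathMul _ f

/-- Orthogonality to `D_A (φ x)`, for all test functions `φ` and all `x` in `H₁`, is the weak
equation `∂(ι* η) = A* η`. The regularity of `η` is thus automatic, as `A* η` is already square
integrable with values in `H₁*`. -/
theorem hasWeakDeriv_of_mem_range_orthogonal {H₀ H₁ : Type*}
    [NormedAddCommGroup H₀] [InnerProductSpace ℝ H₀] [CompleteSpace H₀]
    [NormedAddCommGroup H₁] [InnerProductSpace ℝ H₁]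
    {ι : H₁ →L[ℝ] H₀} {A : ℝ →ᵇ (H₁ →L[ℝ] H₀)} {η : PathL2 H₀}
    (hη : η ∈ (pathOp ι A).rangeᗮ) :
    HasWeakDeriv (fun s => banachAdjoint ι (pathConst (realRiesz H₀) η s))
      (-pathMul (negAdjointPath A) (pathConst (realRiesz H₀) η) : PathL2 (StrongDual ℝ H₁)) := by
  set θ := pathConst (realRiesz H₀) η with hθ
  set κ := pathConst (banachAdjoint ι) θ with hκ
  set ζ : PathL2 (StrongDual ℝ H₁) := -pathMul (negAdjointPath A) θ with hζ
  refine HasWeakDeriv.congr_left (f := κ) ?_ (coeFn_pathConst (banachAdjoint ι) θ)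
  intro φ hφ hc
  have hφd : Continuous (deriv φ) := hφ.continuous_deriv (by simp)
  have i1 := integrable_smul_pathL2 hφd hc.deriv κ
  have i2 := integrable_smul_pathL2 hφ.continuous hc ζ
  ext x
  rw [neg_apply, ContinuousLinearMap.integral_apply i1, ContinuousLinearMap.integral_apply i2,
    eq_neg_iff_add_eq_zero, ← integral_add (i1.apply_continuousLinearMap x)
      (i2.apply_continuousLinearMap x)]
  obtain ⟨ξ, h1, h2⟩ := PathW.exists_smul_const ι hφ hc x
  have h3 := (Submodule.mem_orthogonal _ _).1 hη (pathOp ι A ξ) ⟨ξ, rfl⟩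
  rw [L2.inner_def] at h3
  rw [← h3]
  refine integral_congr_ae ?_
  filter_upwards [h1, h2, coeFn_pathOp ι A ξ, coeFn_pathConst (realRiesz H₀) η,
    coeFn_pathConst (banachAdjoint ι) θ, coeFn_pathMul_negAdjointPath A θ,
    Lp.coeFn_neg (pathMul (negAdjointPath A) θ)] with s g1 g2 g3 g4 g5 g6 g7
  rw [g3, g1, g2, g5, hζ, g7, Pi.neg_apply, g6, hθ, g4, neg_neg]
  simp only [_root_.smul_apply, banachAdjoint_apply_apply, realRiesz_apply, map_smul,
    inner_add_left, real_inner_smul_right, smul_eq_mul, real_inner_comm]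

theorem finiteDimensional_range_orthogonal {H₀ H₁ : Type*}
    [NormedAddCommGroup H₀] [InnerProductSpace ℝ H₀] [CompleteSpace H₀]
    [NormedAddCommGroup H₁] [InnerProductSpace ℝ H₁]
    {ι : H₁ →L[ℝ] H₀} {A : ℝ →ᵇ (H₁ →L[ℝ] H₀)}
    [FiniteDimensional ℝ (pathOp (banachAdjoint ι) (negAdjointPath A)).ker] :
    FiniteDimensional ℝ (pathOp ι A).rangeᗮ := by
  let J : PathL2 H₀ →ₗ[ℝ] PathL2 (StrongDual ℝ H₀) := (pathConst (realRiesz H₀)).toLinearMap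
  let N : PathL2 (StrongDual ℝ H₀) →ₗ[ℝ] PathL2 (StrongDual ℝ H₁) :=
    (pathMul (negAdjointPath A)).toLinearMap
  -- This sends `η` to its dual path together with the weak derivative `A* η`; on the orthogonal
  -- complement of the range it lands in the kernel of `D_A^*`.
  let L : PathL2 H₀ →ₗ[ℝ] WithLp 2 (PathL2 (StrongDual ℝ H₀) × PathL2 (StrongDual ℝ H₁)) :=
    (WithLp.linearEquiv 2 ℝ _).symm.toLinearMap ∘ₗ J.prod (-(N ∘ₗ J))
  let L₁ : (pathOp ι A).rangeᗮ →ₗ[ℝ] PathW (banachAdjoint ι) :=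
    (L.domRestrict _).codRestrict _ fun η => hasWeakDeriv_of_mem_range_orthogonal η.2
  let L₂ : (pathOp ι A).rangeᗮ →ₗ[ℝ] (pathOp (banachAdjoint ι) (negAdjointPath A)).ker :=
    L₁.codRestrict _ fun η => neg_add_cancel (N (J η))
  refine FiniteDimensional.of_injective L₂ fun η η' h => Subtype.ext ?_
  have h1 : (L₁ η).1.fst = (L₁ η').1.fst := by rw [show L₁ η = L₁ η' from congrArg Subtype.val h]
  exact pathConst_realRiesz_injective h1

theorem IsHilbertPair.isFredholm_pathOp {H₀ H₁ : Type*}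
    [NormedAddCommGroup H₀] [InnerProductSpace ℝ H₀] [CompleteSpace H₀]
    [NormedAddCommGroup H₁] [InnerProductSpace ℝ H₁] [CompleteSpace H₁]
    {ι : H₁ →L[ℝ] H₀} (hι : IsHilbertPair ι)
    {A : ℝ → (H₁ →L[ℝ] H₀)} (hA : IsHessianPath ι A) : (pathOp ι hA.toBCF).IsFredholm := by
  obtain ⟨c, hc, T, hT, h⟩ := hA.exists_estimate hι.injective
  obtain ⟨c', hc', T', hT', h'⟩ := hA.exists_estimate_dual hι.injective
  obtain ⟨h1, h2, h3⟩ := (hι.compact.isSmallModFinite.normOnIcc hT).semiFredholm hc h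
  obtain ⟨-, -, h3'⟩ :=
    (hι.compact.isSmallModFinite_banachAdjoint.normOnIcc hT').semiFredholm hc' h'
  have hfin : FiniteDimensional ℝ (pathOp ι hA.toBCF).rangeᗮ :=
    finiteDimensional_range_orthogonal
  have : CompleteSpace (pathOp ι hA.toBCF).range := h2.completeSpace_coe
  -- The range is closed by the first estimate, so its orthogonal complement is an algebraic
  -- complement; the dual estimate enters only through the finite dimension of that complement.
  have hcoker : (pathOp ι hA.toBCF).range.CoFG :=
    ((Submodule.fg_iff_finiteDimensional _).2 hfin).cofg_of_isCompl
      (Submodule.isCompl_orthogonal _).symm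
  exact ⟨h1, h2, h3, hcoker, .of_finiteDimensional _⟩

theorem mainTheorem8 {H₀ H₁ : Type*}
    [NormedAddCommGroup H₀] [InnerProductSpace ℝ H₀] [CompleteSpace H₀]
    [NormedAddCommGroup H₁] [InnerProductSpace ℝ H₁] [CompleteSpace H₁]
    (ι : H₁ →L[ℝ] H₀) (hι : IsHilbertPair ι)
    (A : ℝ → (H₁ →L[ℝ] H₀)) (hA : IsHessianPath ι A) :
    (∃ c > 0, ∃ T > 0, ∀ ξ : PathW ι,
      ‖ξ‖ ≤ c * (normOnIcc T ξ + ‖pathOp ι hA.toBCF ξ‖)) ∧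
    (∃ c > 0, ∃ T > 0, ∀ η : PathW (banachAdjoint ι),
      ‖η‖ ≤ c * (normOnIcc T η + ‖pathOp (banachAdjoint ι) (negAdjointPath hA.toBCF) η‖)) ∧
    (pathOp ι hA.toBCF).IsFredholm :=
  ⟨hA.exists_estimate hι.injective, hA.exists_estimate_dual hι.injective,
    hι.isFredholm_pathOp hA⟩
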